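/- Let $p_1,p_2>0$ and $\alpha,\beta\in\mathbb R$, let $\beta^{\pm}_{ij}$ ($i=1,2$, $j=0,1$) be real numbers, and let $q$ be a real-valued function that is continuous on $[-\pi,0)$ and on $(0,\pi]$ and has finite limits $q(0\mp)$. Put $p=p_1$ on $[-\pi,0)$ and $p=p_2$ on $(0,\pi]$. Consider the problem $$-p(x)y''+q(x)y=\lambda y\quad\text{on }[-\pi,0)\text{ and }(0,\pi],$$ $$\cos\alpha\, y(-\pi)+\sin\alpha\, y'(-\pi)=0,\qquad \cos\beta\, y(\pi)+\sin\beta\, y'(\pi)=0,$$ $$\beta^-_{i1}y'(0-)+\beta^-_{i0}y(0-)+\beta^+_{i1}y'(0+)+\beta^+_{i0}y(0+)=0\qquad(i=1,2),$$ with eigenparameter $\lambda\in\mathbb C$. Let $\Delta_{ij}$ be the determinant of the $i$-th and $j$-th columns of $$\begin{pmatrix}\beta^+_{10}&\beta^+_{11}&\beta^-_{10}&\beta^-_{11}\\ \beta^+_{20}&\beta^+_{21}&\beta^-_{20}&\beta^-_{21}\end{pmatrix},$$ and assume $\Delta_{12}>0$ and $\Delta_{34}>0$. For square-integrable real functions $f,g$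 on $[-\pi,0)\cup(0,\pi]$ write $$\langle f,g\rangle=\frac{\Delta_{34}}{p_1}\int_{-\pi}^0 fg\,dx+\frac{\Delta_{12}}{p_2}\int_0^{\pi} fg\,dx .$$ For real $\lambda$ let $\phi(\cdot,\lambda)$ be the solution of the differential equation on the two intervals that is determined by $\phi(-\pi)=\sin\alpha$, $\phi'(-\pi)=-\cos\alpha$ and $$\phi(0+)=\frac{1}{\Delta_{12}}\bigl(\Delta_{23}\phi(0-)+\Delta_{24}\phi'(0-)\bigr),\qquad \phi'(0+)=\frac{-1}{\Delta_{12}}\bigl(\Delta_{13}\phi(0-)+\Delta_{14}\phi'(0-)\bigr).$$ Then the eigenvalues of the problem are real and form a countably infinite set. If $\lambda_0,\lambda_1,\lambda_2,\dots$ is any enumeration of them without repetition, $\phi_n=\phi(\cdot,\lambda_n)$, $\varphi_n=\langle\phi_n,\phi_n\rangle^{-1/2}\phi_n$ and $c_n(f)=\langle f,\varphi_n\rangle$, then for every real-valued square-integrable function $f$ on $[-\pi,0)\cup(0,\pi]$ the modified Parseval equality $$\frac{\Delta_{34}}{p_1}\int_{-\pi}^0 f^2(x)\,dx+\frac{\Delta_{12}}{p_2}\int_0^{\pi}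 f^2(x)\,dx=\sum_{n=0}^{\infty}c_n(f)^2$$ holds. -/

import Mathlib

open Real Set Filter Topology MeasureTheory

noncomputable section

/-- The data of the two-interval problem
`-p y'' + q y = lam y` on `[-π, 0)` and `(0, π]`, with `p = p₁` on the left and `p = p₂` on the
right, boundary angles `α`, `β`, and transmission coefficients at `0`. The entry `bm i j` is
`β⁻_{i+1, j}` and `bp i j` is `β⁺_{i+1, j}`; the index `j` is the order of the derivative. -/
structure TwoIntervalSL where
  p₁ : ℝ
  p₂ : ℝ
  q : ℝ → ℝ
  α : ℝ
  β : ℝ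
  bm : Fin 2 → Fin 2 → ℝ
  bp : Fin 2 → Fin 2 → ℝ

namespace TwoIntervalSL

variable {𝕜 : Type*} [RCLike 𝕜]

/-- The `2 × 4` matrix of transmission coefficients. -/
def T (P : TwoIntervalSL) : Matrix (Fin 2) (Fin 4) ℝ :=
  !![P.bp 0 0, P.bp 0 1, P.bm 0 0, P.bm 0 1;
     P.bp 1 0, P.bp 1 1, P.bm 1 0, P.bm 1 1]

/-- The determinant formed by columns `i` and `j` of `T`. Columns are counted from `0` here. -/
def minor (P : TwoIntervalSL) (i j : Fin 4) : ℝ :=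
  P.T 0 i * P.T 1 j - P.T 0 j * P.T 1 i

def Δ₁₂ (P : TwoIntervalSL) : ℝ := P.minor 0 1
def Δ₁₃ (P : TwoIntervalSL) : ℝ := P.minor 0 2
def Δ₁₄ (P : TwoIntervalSL) : ℝ := P.minor 0 3
def Δ₂₃ (P : TwoIntervalSL) : ℝ := P.minor 1 2
def Δ₂₄ (P : TwoIntervalSL) : ℝ := P.minor 1 3
def Δ₃₄ (P : TwoIntervalSL) : ℝ := P.minor 2 3

/-- The potential is continuous on `[-π, 0)` and on `(0, π]`, with finite limits at `0∓`. -/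
def PotentialRegular (P : TwoIntervalSL) : Prop :=
  ContinuousOn P.q (Ico (-π) 0) ∧ ContinuousOn P.q (Ioc 0 π) ∧
    (∃ l : ℝ, Tendsto P.q (𝓝[<] 0) (𝓝 l)) ∧ ∃ r : ℝ, Tendsto P.q (𝓝[>] 0) (𝓝 r)

/-- On the interval `I`, `y` has derivative `dy`, `dy` is differentiable, and
`-p y'' + q y = lam y` (derivatives are one-sided at an end point belonging to `I`). -/
def SolvesOn (p : ℝ) (q : ℝ → ℝ) (lam : 𝕜) (I : Set ℝ) (y dy : ℝ → 𝕜) : Prop :=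
  ∀ x ∈ I, HasDerivWithinAt y (dy x) I x ∧
    ∃ d : 𝕜, HasDerivWithinAt dy d I x ∧ -(p • d) + q x • y x = lam * y x

/-- `y`, with derivative `dy`, solves the differential equation on both intervals.
Values outside `[-π, 0) ∪ (0, π]` play no role. -/
def IsSolution (P : TwoIntervalSL) (lam : 𝕜) (y dy : ℝ → 𝕜) : Prop :=
  SolvesOn P.p₁ P.q lam (Ico (-π) 0) y dy ∧ SolvesOn P.p₂ P.q lam (Ioc 0 π) y dy

/-- `y(0-) = a₀`, `y'(0-) = a₁`, `y(0+) = b₀`, `y'(0+) = b₁`. -/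
def HasTraces (y dy : ℝ → 𝕜) (a₀ a₁ b₀ b₁ : 𝕜) : Prop :=
  Tendsto y (𝓝[<] 0) (𝓝 a₀) ∧ Tendsto dy (𝓝[<] 0) (𝓝 a₁) ∧
    Tendsto y (𝓝[>] 0) (𝓝 b₀) ∧ Tendsto dy (𝓝[>] 0) (𝓝 b₁)

/-- The two boundary conditions at `∓π` and the two transmission conditions at `0`. -/
def SatisfiesBTC (P : TwoIntervalSL) (y dy : ℝ → 𝕜) : Prop :=
  cos P.α • y (-π) + sin P.α • dy (-π) = 0 ∧
  cos P.β • y π + sin P.β • dy π = 0 ∧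
  ∃ a₀ a₁ b₀ b₁ : 𝕜, HasTraces y dy a₀ a₁ b₀ b₁ ∧
    ∀ i : Fin 2, P.bm i 1 • a₁ + P.bm i 0 • a₀ + P.bp i 1 • b₁ + P.bp i 0 • b₀ = 0

/-- `lam` is a (complex) eigenvalue: the problem has a nontrivial solution. -/
def IsEigenvalue (P : TwoIntervalSL) (lam : ℂ) : Prop :=
  ∃ y dy : ℝ → ℂ, P.IsSolution lam y dy ∧ P.SatisfiesBTC y dy ∧
    ∃ x ∈ Ico (-π) 0 ∪ Ioc 0 π, y x ≠ 0

/-- `u` is the solution `φ(·, lam)`: it starts from `u(-π) = sin α`, `u'(-π) = -cos α` on the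
left, and is continued to the right by the initial values at `0+` that are computed from
its limits at `0-`. -/
def IsPhi (P : TwoIntervalSL) (lam : 𝕜) (u : ℝ → 𝕜) : Prop :=
  ∃ du : ℝ → 𝕜, P.IsSolution lam u du ∧
    u (-π) = (sin P.α : ℝ) • (1 : 𝕜) ∧ du (-π) = (-cos P.α : ℝ) • (1 : 𝕜) ∧
    ∃ a₀ a₁ b₀ b₁ : 𝕜, HasTraces u du a₀ a₁ b₀ b₁ ∧
      b₀ = (1 / P.Δ₁₂) • (P.Δ₂₃ • a₀ + P.Δ₂₄ • a₁) ∧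
      b₁ = (-1 / P.Δ₁₂) • (P.Δ₁₃ • a₀ + P.Δ₁₄ • a₁)

/-- `lam 0, lam 1, …` lists every eigenvalue exactly once, and `φ n = φ(·, lam n)`. -/
def IsEigensystem (P : TwoIntervalSL) (lam : ℕ → ℝ) (φ : ℕ → ℝ → ℝ) : Prop :=
  Function.Injective lam ∧ (∀ z : ℂ, P.IsEigenvalue z ↔ ∃ n, z = (lam n : ℂ)) ∧
    ∀ n, P.IsPhi (lam n) (φ n)

/-- The weighted inner product. -/
def form (P : TwoIntervalSL) (f g : ℝ → ℝ) : ℝ :=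
  P.Δ₃₄ / P.p₁ * (∫ x in (-π)..0, f x * g x) + P.Δ₁₂ / P.p₂ * ∫ x in (0)..π, f x * g x

/-- The function `u` divided by its weighted norm. -/
def normalized (P : TwoIntervalSL) (u : ℝ → ℝ) : ℝ → ℝ :=
  fun x => (P.form u u) ^ (-(1 / 2) : ℝ) * u x

/-- The Fourier coefficient `c_n(f)` with respect to the normalized eigenfunctions. -/
def coeff (P : TwoIntervalSL) (φ : ℕ → ℝ → ℝ) (f : ℝ → ℝ) (n : ℕ) : ℝ :=
  P.form f (P.normalized (φ n))

end TwoIntervalSL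

end

/-!
The eigenfunctions form an orthogonal basis of the weighted `L²` space because they are the
eigenvectors of a compact symmetric operator with trivial kernel; the assertion is Parseval's
equality for that basis.

The weights are chosen so that Green's identity has no boundary term at `0`: the transmission
conditions multiply the Wronskian by `Δ₃₄ / Δ₁₂` (`Sol.wronskian_zero`, from the Plücker relation).
Hence eigenfunctions for different eigenvalues are orthogonal (`Sol.inner_vec_eq_zero`), and, `L²`
being separable, only countably many real numbers are eigenvalues. For a non-real eigenvalue the
function `Im (conj y * y')` would be monotone in the same direction on both intervals, vanish at
`±π`, and have limits of the same sign at `0-` and `0+`, which forces `y = 0`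
(`IsEigenvalue.im_eq_zero`).

Fix a real number that is not an eigenvalue, and let `φ` and `χ` solve the equation there with the
left and the right boundary condition. Up to a factor, the resolvent is the integral operator with
kernel `φ (min x t) * χ (max x t)`. It is compact, by the Arzelà–Ascoli theorem, and symmetric
(`exists_green_operator`). An eigenvector for a nonzero eigenvalue has a smooth representative,
which is a classical eigenfunction (`Sol.exists_of_green_eigenvector`). The kernel is trivial by
Lebesgue's differentiation theorem (`Sol.ae_eq_zero_of_green_eq_zero`). The spectral theorem then
shows that the eigenfunctions are total. Since eigenvalues are simple, `φ(·, λₙ)` spans the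
eigenspace of `λₙ`. Since the `L²` space has infinite dimension, there are infinitely many
eigenvalues.

Existence for linear initial value problems on the whole interval is obtained from the Prüfer angle
(`exists_pruefer_angle`), and uniqueness from the constancy of Wronskians
(`eq_zero_of_initial_zero`).
-/

noncomputable section

/-! ### Linear second order equations -/

/-- `u` is a solution of `u'' = k u` on `[a, b]` with derivative `v`. The functions are defined and
continuous on the whole line, and the derivatives at `a` and `b` are two-sided. -/
structure IsSolPair (k : ℝ → ℝ) (a b : ℝ) (u v : ℝ → ℝ) : Prop where
  cont_u : Continuous u
  cont_v : Continuous v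
  deriv_u : ∀ x ∈ Icc a b, HasDerivAt u (v x) x
  deriv_v : ∀ x ∈ Icc a b, HasDerivAt v (k x * u x) x

/-- The Prüfer angle: the vector field is bounded and Lipschitz in the angle, so that the
Picard–Lindelöf theorem applies to the whole interval at once. -/
theorem exists_pruefer_angle {k : ℝ → ℝ} (hk : Continuous k) {a b x₀ : ℝ} (hx₀ : x₀ ∈ Icc a b)
    (θ₀ : ℝ) :
    ∃ θ : ℝ → ℝ, Continuous θ ∧ θ x₀ = θ₀ ∧
      ∀ x ∈ Icc a b, HasDerivAt θ ((k x - 1) / 2 + (k x + 1) / 2 * cos (2 * θ x)) x := by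
  obtain ⟨C, hC⟩ := (isCompact_Icc (a := a - 1) (b := b + 1)).exists_bound_of_continuousOn
    hk.continuousOn
  have hab : a ≤ b := hx₀.1.trans hx₀.2
  have hC0 : 0 ≤ C := (norm_nonneg _).trans (hC a ⟨by linarith, by linarith⟩)
  have hx₁ : x₀ ∈ Icc (a - 1) (b + 1) := ⟨by linarith [hx₀.1], by linarith [hx₀.2]⟩
  have hkC : ∀ t ∈ Icc (a - 1) (b + 1), |k t - 1| ≤ 1 + C ∧ |k t + 1| ≤ 1 + C := by
    intro t ht
    have h := abs_le.1 (by simpa using hC t ht)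
    constructor <;> rw [abs_le] <;> constructor <;> linarith
  have hPL : IsPicardLindelof
      (fun t θ : ℝ => (k t - 1) / 2 + (k t + 1) / 2 * cos (2 * θ)) (⟨x₀, hx₁⟩ : Icc (a - 1) (b + 1))
      θ₀ (Real.toNNReal ((1 + C) * (b - a + 2))) 0 (Real.toNNReal (1 + C))
      (Real.toNNReal (1 + C)) := by
    refine ⟨fun t ht => ?_, fun x _ => by fun_prop, fun t ht x _ => ?_, ?_⟩
    · refine LipschitzOnWith.of_dist_le_mul fun x _ y _ => ?_
      rw [Real.coe_toNNReal _ (by linarith), Real.dist_eq, Real.dist_eq]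
      have h1 : |cos (2 * x) - cos (2 * y)| ≤ 2 * |x - y| := by
        have := Real.abs_cos_sub_cos_le (2 * x) (2 * y)
        rwa [← mul_sub, abs_mul, abs_two] at this
      have h2 : ((k t - 1) / 2 + (k t + 1) / 2 * cos (2 * x))
          - ((k t - 1) / 2 + (k t + 1) / 2 * cos (2 * y))
          = (k t + 1) / 2 * (cos (2 * x) - cos (2 * y)) := by ring
      rw [h2, abs_mul, abs_div, abs_two]
      have h3 := (hkC t ht).2
      calc |k t + 1| / 2 * |cos (2 * x) - cos (2 * y)| ≤ (1 + C) / 2 * (2 * |x - y|) := by gcongr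
        _ = _ := by ring
    · rw [Real.coe_toNNReal _ (by linarith), Real.norm_eq_abs]
      have h1 := (hkC t ht).1
      have h3 := (hkC t ht).2
      have h4 := Real.abs_cos_le_one (2 * x)
      calc _ ≤ |(k t - 1) / 2| + |(k t + 1) / 2 * cos (2 * x)| := abs_add_le _ _
        _ = |k t - 1| / 2 + |k t + 1| / 2 * |cos (2 * x)| := by
          rw [abs_mul, abs_div, abs_div, abs_two]
        _ ≤ (1 + C) / 2 + (1 + C) / 2 * 1 := by gcongr
        _ = _ := by ring
    · rw [Real.coe_toNNReal _ (by linarith), Real.coe_toNNReal _ (by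
        apply mul_nonneg <;> linarith)]
      simp only [NNReal.coe_zero, sub_zero]
      gcongr
      apply max_le <;> linarith [hx₀.1, hx₀.2]
  obtain ⟨θ, hθ0, hθ⟩ := hPL.exists_eq_forall_mem_Icc_hasDerivWithinAt₀
  have hcont : ContinuousOn θ (Icc (a - 1) (b + 1)) := fun t ht => (hθ t ht).continuousWithinAt
  have hle : a - 1 ≤ b + 1 := by linarith
  refine ⟨IccExtend hle ((Icc (a - 1) (b + 1)).domRestrict θ),
    (continuousOn_iff_continuous_domRestrict.1 hcont).Icc_extend', ?_, fun x hx => ?_⟩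
  · rw [IccExtend_of_mem _ _ hx₁]; exact hθ0
  · have hx' : x ∈ Ioo (a - 1) (b + 1) := ⟨by linarith [hx.1], by linarith [hx.2]⟩
    have hd := (hθ x (Ioo_subset_Icc_self hx')).hasDerivAt (Icc_mem_nhds hx'.1 hx'.2)
    rw [IccExtend_of_mem _ _ (Ioo_subset_Icc_self hx')]
    refine hd.congr_of_eventuallyEq ?_
    filter_upwards [Icc_mem_nhds hx'.1 hx'.2] with y hy
    rw [IccExtend_of_mem _ _ hy]; rfl

theorem exists_isSolPair {k : ℝ → ℝ} (hk : Continuous k) {a b x₀ : ℝ} (hx₀ : x₀ ∈ Icc a b)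
    (c₀ c₁ : ℝ) : ∃ u v : ℝ → ℝ, IsSolPair k a b u v ∧ u x₀ = c₀ ∧ v x₀ = c₁ := by
  obtain ⟨ρ, θ₀, h₀, h₁⟩ : ∃ ρ θ₀ : ℝ, ρ * cos θ₀ = c₀ ∧ ρ * sin θ₀ = c₁ :=
    ⟨‖(⟨c₀, c₁⟩ : ℂ)‖, Complex.arg ⟨c₀, c₁⟩, by simp, by simp⟩
  obtain ⟨θ, hθc, hθ0, hθ⟩ := exists_pruefer_angle hk hx₀ θ₀
  set m : ℝ → ℝ := fun t => (1 + k t) * (sin (θ t) * cos (θ t)) with hm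
  have hmc : Continuous m := by fun_prop
  set r : ℝ → ℝ := fun t => ρ * exp (∫ s in x₀..t, m s) with hr
  have hrd : ∀ x, HasDerivAt r (r x * m x) x := fun x => by
    have := ((hmc.integral_hasStrictDerivAt x₀ x).hasDerivAt.exp).const_mul ρ
    rwa [← mul_assoc] at this
  have hrc : Continuous r := continuous_iff_continuousAt.2 fun x => (hrd x).continuousAt
  refine ⟨fun t => r t * cos (θ t), fun t => r t * sin (θ t),
    ⟨by fun_prop, by fun_prop, fun x hx => ?_, fun x hx => ?_⟩, ?_, ?_⟩
  · refine ((hrd x).mul (hθ x hx).cos).congr_deriv ?_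
    simp only [cos_two_mul, hm]
    ring
  · refine ((hrd x).mul (hθ x hx).sin).congr_deriv ?_
    simp only [cos_two_mul, hm]
    linear_combination (1 + k x) * r x * cos (θ x) * sin_sq_add_cos_sq (θ x)
  · simp [hr, hθ0, h₀]
  · simp [hr, hθ0, h₁]

theorem Convex.eq_of_hasDerivWithinAt_zero {s : Set ℝ} (hs : Convex ℝ s) {f : ℝ → ℝ}
    (hf : ∀ x ∈ s, HasDerivWithinAt f 0 s x) {x y : ℝ} (hx : x ∈ s) (hy : y ∈ s) : f x = f y := by
  have := hs.norm_image_sub_le_of_norm_hasDerivWithin_le (C := 0) hf (by simp) hx hy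
  rw [zero_mul, norm_le_zero_iff, sub_eq_zero] at this
  exact this.symm

theorem HasDerivWithinAt.wronskian {s : Set ℝ} {k₁ k₂ u₁ v₁ u₂ v₂ : ℝ → ℝ} {x : ℝ}
    (hu₁ : HasDerivWithinAt u₁ (v₁ x) s x) (hv₁ : HasDerivWithinAt v₁ (k₁ x * u₁ x) s x)
    (hu₂ : HasDerivWithinAt u₂ (v₂ x) s x) (hv₂ : HasDerivWithinAt v₂ (k₂ x * u₂ x) s x) :
    HasDerivWithinAt (fun t => u₁ t * v₂ t - v₁ t * u₂ t) ((k₂ x - k₁ x) * (u₁ x * u₂ x)) s x := by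
  refine ((hu₁.mul hv₂).sub (hv₁.mul hu₂)).congr_deriv ?_
  ring

/-- Uniqueness for the initial value problem on a convex set. The value at `x₁` is read off from
the constant Wronskian with the solutions normalized at `x₁`. -/
theorem eq_zero_of_initial_zero {k : ℝ → ℝ} (hk : Continuous k) {a b : ℝ} {s : Set ℝ}
    (hs : Convex ℝ s) (hsab : s ⊆ Icc a b) {D E : ℝ → ℝ}
    (hD : ∀ x ∈ s, HasDerivWithinAt D (E x) s x)
    (hE : ∀ x ∈ s, HasDerivWithinAt E (k x * D x) s x) {x₀ : ℝ} (hx₀ : x₀ ∈ s)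
    (hD0 : D x₀ = 0) (hE0 : E x₀ = 0) {x : ℝ} (hx : x ∈ s) : D x = 0 ∧ E x = 0 := by
  have key : ∀ c₀ c₁ : ℝ, D x * c₁ - E x * c₀ = 0 := by
    intro c₀ c₁
    obtain ⟨u, v, h, rfl, rfl⟩ := exists_isSolPair hk (hsab hx) c₀ c₁
    have := hs.eq_of_hasDerivWithinAt_zero (f := fun t => D t * v t - E t * u t) (fun y hy => by
      have := (hD y hy).wronskian (hE y hy) (h.deriv_u y (hsab hy)).hasDerivWithinAt
        (h.deriv_v y (hsab hy)).hasDerivWithinAt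
      simpa using this) hx hx₀
    simpa [hD0, hE0] using this
  exact ⟨by simpa using key 0 1, by simpa using key 1 0⟩

theorem IsSolPair.wronskian_hasDerivAt {k₁ k₂ u₁ v₁ u₂ v₂ : ℝ → ℝ} {a b : ℝ}
    (h₁ : IsSolPair k₁ a b u₁ v₁) (h₂ : IsSolPair k₂ a b u₂ v₂) {x : ℝ} (hx : x ∈ Icc a b) :
    HasDerivAt (fun t => u₁ t * v₂ t - v₁ t * u₂ t) ((k₂ x - k₁ x) * (u₁ x * u₂ x)) x := by
  rw [← hasDerivWithinAt_univ]
  exact (h₁.deriv_u x hx).hasDerivWithinAt.wronskian (h₁.deriv_v x hx).hasDerivWithinAt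
    (h₂.deriv_u x hx).hasDerivWithinAt (h₂.deriv_v x hx).hasDerivWithinAt

theorem IsSolPair.wronskian_const {k u₁ v₁ u₂ v₂ : ℝ → ℝ} {a b : ℝ}
    (h₁ : IsSolPair k a b u₁ v₁) (h₂ : IsSolPair k a b u₂ v₂) {x y : ℝ} (hx : x ∈ Icc a b)
    (hy : y ∈ Icc a b) : u₁ x * v₂ x - v₁ x * u₂ x = u₁ y * v₂ y - v₁ y * u₂ y :=
  (convex_Icc a b).eq_of_hasDerivWithinAt_zero (f := fun t => u₁ t * v₂ t - v₁ t * u₂ t)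
    (fun z hz => by simpa using (h₁.wronskian_hasDerivAt h₂ hz).hasDerivWithinAt) hx hy

/-- Green's identity on one interval. -/
theorem IsSolPair.integral_wronskian {k₁ k₂ u₁ v₁ u₂ v₂ : ℝ → ℝ} {a b c : ℝ} (hab : a ≤ b)
    (h₁ : IsSolPair k₁ a b u₁ v₁) (h₂ : IsSolPair k₂ a b u₂ v₂)
    (hc : ∀ x, k₂ x - k₁ x = c) :
    c * ∫ x in a..b, u₁ x * u₂ x =
      (u₁ b * v₂ b - v₁ b * u₂ b) - (u₁ a * v₂ a - v₁ a * u₂ a) := by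
  have := h₁.cont_u
  have := h₂.cont_u
  rw [← intervalIntegral.integral_const_mul]
  refine intervalIntegral.integral_eq_sub_of_hasDerivAt
    (f := fun t => u₁ t * v₂ t - v₁ t * u₂ t) (fun x hx => ?_)
    (Continuous.intervalIntegrable (by fun_prop) _ _)
  rw [uIcc_of_le hab] at hx
  simpa [hc] using h₁.wronskian_hasDerivAt h₂ hx

theorem IsSolPair.eq_of_initial_eq {k u₁ v₁ u₂ v₂ : ℝ → ℝ} (hk : Continuous k) {a b : ℝ}
    (h₁ : IsSolPair k a b u₁ v₁) (h₂ : IsSolPair k a b u₂ v₂) {x₀ : ℝ} (hx₀ : x₀ ∈ Icc a b)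
    (hu : u₁ x₀ = u₂ x₀) (hv : v₁ x₀ = v₂ x₀) {x : ℝ} (hx : x ∈ Icc a b) :
    u₁ x = u₂ x ∧ v₁ x = v₂ x := by
  have := eq_zero_of_initial_zero hk (convex_Icc a b) le_rfl
    (D := fun t => u₁ t - u₂ t) (E := fun t => v₁ t - v₂ t)
    (fun y hy => ((h₁.deriv_u y hy).sub (h₂.deriv_u y hy)).hasDerivWithinAt)
    (fun y hy => by
      have := ((h₁.deriv_v y hy).sub (h₂.deriv_v y hy)).hasDerivWithinAt (s := Icc a b)
      rwa [← mul_sub] at this)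
    hx₀ (sub_eq_zero.2 hu) (sub_eq_zero.2 hv) hx
  exact ⟨sub_eq_zero.1 this.1, sub_eq_zero.1 this.2⟩

theorem IsSolPair.const_mul {k u v : ℝ → ℝ} {a b : ℝ} (h : IsSolPair k a b u v) (c : ℝ) :
    IsSolPair k a b (fun x => c * u x) (fun x => c * v x) where
  cont_u := h.cont_u.const_mul c
  cont_v := h.cont_v.const_mul c
  deriv_u x hx := (h.deriv_u x hx).const_mul c
  deriv_v x hx := by
    rw [mul_left_comm]
    exact (h.deriv_v x hx).const_mul c

/-! ### Integral operators with a Green kernel -/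

section CompactInner

variable {X H : Type*} [TopologicalSpace X] [CompactSpace X] [NormedAddCommGroup H]
  [InnerProductSpace ℝ H]

open scoped BoundedContinuousFunction InnerProductSpace

/-- The operator that sends `f` to the function `x ↦ ⟪κ x, f⟫`, for a continuous family `κ` of
vectors over a compact space. -/
def innerFamily (κ : C(X, H)) : H →L[ℝ] (X →ᵇ ℝ) :=
  LinearMap.mkContinuous
    { toFun := fun f => BoundedContinuousFunction.mkOfCompact
        ⟨fun x => ⟪κ x, f⟫_ℝ, by fun_prop⟩
      map_add' := fun f g => by ext x; simp [inner_add_right]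
      map_smul' := fun c f => by ext x; simp [inner_smul_right] }
    ‖κ‖ (fun f => by
      refine (BoundedContinuousFunction.norm_le (by positivity)).2 fun x => ?_
      refine (norm_inner_le_norm (κ x) f).trans ?_
      gcongr
      exact κ.norm_coe_le_norm x)

@[simp]
theorem innerFamily_apply (κ : C(X, H)) (f : H) (x : X) : innerFamily κ f x = ⟪κ x, f⟫_ℝ := rfl

/-- The unit ball is mapped to a bounded equicontinuous family of functions. -/
theorem isCompactOperator_innerFamily (κ : C(X, H)) : IsCompactOperator (innerFamily κ) := by
  refine (isCompactOperator_iff_isCompact_closure_image_closedBall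
    (innerFamily κ).toLinearMap one_pos).2 ?_
  refine BoundedContinuousFunction.arzela_ascoli (Metric.closedBall 0 ‖κ‖)
    (isCompact_closedBall _ _) _ ?_ ?_
  · rintro _ x ⟨f, hf, rfl⟩
    rw [mem_closedBall_zero_iff] at hf ⊢
    refine (norm_inner_le_norm (κ x) f).trans ?_
    calc ‖κ x‖ * ‖f‖ ≤ ‖κ‖ * 1 := by
          gcongr
          exact κ.norm_coe_le_norm x
      _ = ‖κ‖ := mul_one _
  · intro x₀
    rw [Metric.equicontinuousAt_iff_right]
    intro ε hε
    have := Metric.tendsto_nhds.1 (κ.continuous.tendsto x₀) ε hε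
    filter_upwards [this] with x hx
    rintro ⟨_, f, hf, rfl⟩
    rw [mem_closedBall_zero_iff] at hf
    rw [dist_comm, Real.dist_eq]
    change |⟪κ x, f⟫_ℝ - ⟪κ x₀, f⟫_ℝ| < ε
    rw [← inner_sub_left]
    calc |⟪κ x - κ x₀, f⟫_ℝ| ≤ ‖κ x - κ x₀‖ * ‖f‖ := abs_real_inner_le_norm _ _
      _ ≤ ‖κ x - κ x₀‖ * 1 := by gcongr
      _ < ε := by rwa [mul_one, ← dist_eq_norm]

end CompactInner

section GreenOperator

open scoped BoundedContinuousFunction InnerProductSpace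

variable {μ : Measure ℝ} {φ χ : ℝ → ℝ}

theorem inner_toLp {f g : ℝ → ℝ} (hf : MemLp f 2 μ) (hg : MemLp g 2 μ) :
    ⟪hf.toLp f, hg.toLp g⟫_ℝ = ∫ x, f x * g x ∂μ := by
  rw [L2.inner_def]
  refine integral_congr_ae ?_
  filter_upwards [hf.coeFn_toLp, hg.coeFn_toLp] with x h₁ h₂
  rw [h₁, h₂]
  simp [mul_comm]

theorem inner_toLp_left {f : ℝ → ℝ} (hf : MemLp f 2 μ) (g : Lp ℝ 2 μ) :
    ⟪hf.toLp f, g⟫_ℝ = ∫ x, f x * g x ∂μ := by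
  conv_lhs => rw [← Lp.toLp_coeFn g (Lp.memLp g)]
  exact inner_toLp hf (Lp.memLp g)

/-- The restriction of `φ` to `(-∞, x]`, as a vector of `L²`. -/
def cutoff (hφ : MemLp φ 2 μ) (x : ℝ) : Lp ℝ 2 μ :=
  (hφ.indicator (measurableSet_Iic (a := x))).toLp _

theorem inner_cutoff (hφ : MemLp φ 2 μ) (x : ℝ) (f : Lp ℝ 2 μ) :
    ⟪cutoff hφ x, f⟫_ℝ = ∫ t in Iic x, φ t * f t ∂μ := by
  rw [cutoff, inner_toLp_left, ← integral_indicator measurableSet_Iic]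
  congr 1 with t
  rw [indicator_mul_left]

theorem inner_cutoff_cutoff (hφ : MemLp φ 2 μ) (x y : ℝ) :
    ⟪cutoff hφ x, cutoff hφ y⟫_ℝ = ∫ t in Iic (min x y), φ t * φ t ∂μ := by
  rw [cutoff, cutoff, inner_toLp, ← integral_indicator measurableSet_Iic]
  congr 1 with t
  simp only [indicator, mem_Iic, le_min_iff]
  by_cases h₁ : t ≤ x <;> by_cases h₂ : t ≤ y <;> simp [h₁, h₂]

/-- The squared distance of two cutoffs is the integral of `φ ^ 2` between the cutting points. -/
theorem continuous_cutoff [NullSingletonClass μ] (hφ : MemLp φ 2 μ) : Continuous (cutoff hφ) := by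
  have hint : Integrable (fun t => φ t * φ t) μ := hφ.integrable_mul hφ
  set m : ℝ → ℝ := fun x => ∫ t in Iic x, φ t * φ t ∂μ with hm
  have hmc : Continuous m := by
    have : m = fun x => m 0 + ∫ t in (0 : ℝ)..x, φ t * φ t ∂μ := by
      ext x
      rw [← intervalIntegral.integral_Iic_sub_Iic hint.integrableOn hint.integrableOn]
      simp [hm]
    rw [this]
    exact continuous_const.add (intervalIntegral.continuous_primitive
      (fun a b => hint.intervalIntegrable) 0)
  have hnorm : ∀ x y, ‖cutoff hφ y - cutoff hφ x‖ ^ 2 = m y - 2 * m (min y x) + m x := by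
    intro x y
    rw [norm_sub_sq_real, ← real_inner_self_eq_norm_sq, ← real_inner_self_eq_norm_sq,
      inner_cutoff_cutoff, inner_cutoff_cutoff, inner_cutoff_cutoff, min_self, min_self]
  refine continuous_iff_continuousAt.2 fun x => ?_
  rw [ContinuousAt, tendsto_iff_norm_sub_tendsto_zero]
  have h : Tendsto (fun y => √(m y - 2 * m (min y x) + m x)) (𝓝 x)
      (𝓝 (√(m x - 2 * m (min x x) + m x))) :=
    (Continuous.tendsto (by fun_prop) x)
  rw [min_self, show m x - 2 * m x + m x = 0 by ring, sqrt_zero] at h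
  refine h.congr fun y => ?_
  rw [← hnorm, sqrt_sq (norm_nonneg _)]

theorem norm_mul_projIcc_le {a b : ℝ} (hab : a ≤ b) {c : ℝ → ℝ} {C : ℝ}
    (hC : ∀ᵐ x ∂μ, ‖c x‖ ≤ C) (g : Icc a b →ᵇ ℝ) :
    ∀ᵐ x ∂μ, ‖c x * g (projIcc a b hab x)‖ ≤ C * ‖g‖ := by
  filter_upwards [hC] with x hx
  rw [norm_mul]
  exact mul_le_mul hx (g.norm_coe_le_norm _) (norm_nonneg _) ((norm_nonneg _).trans hx)

theorem memLp_mul_projIcc [IsFiniteMeasure μ] {a b : ℝ} (hab : a ≤ b) {c : ℝ → ℝ}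
    (hc : AEStronglyMeasurable c μ) {C : ℝ} (hC : ∀ᵐ x ∂μ, ‖c x‖ ≤ C) (g : Icc a b →ᵇ ℝ) :
    MemLp (fun x => c x * g (projIcc a b hab x)) 2 μ :=
  MemLp.of_bound (hc.mul (g.continuous.comp continuous_projIcc).aestronglyMeasurable) _
    (norm_mul_projIcc_le hab hC g)

/-- Multiplication of a continuous function on `[a, b]` by a bounded function `c`, as an operator
into `L²`. -/
def mulToLp [IsFiniteMeasure μ] {a b : ℝ} (hab : a ≤ b) {c : ℝ → ℝ}
    (hc : AEStronglyMeasurable c μ) {C : ℝ} (hC : ∀ᵐ x ∂μ, ‖c x‖ ≤ C) :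
    (Icc a b →ᵇ ℝ) →L[ℝ] Lp ℝ 2 μ :=
  LinearMap.mkContinuous
    { toFun := fun g => (memLp_mul_projIcc hab hc hC g).toLp _
      map_add' := fun f g => by
        rw [← MemLp.toLp_add]
        congr 1 with x
        simp [mul_add]
      map_smul' := fun r g => by
        rw [← MemLp.toLp_const_smul]
        congr 1 with x
        simp [mul_left_comm] }
    (measureUnivNNReal μ ^ (2 : ENNReal).toReal⁻¹ * |C|) (fun g => by
      rw [mul_assoc]
      refine Lp.norm_le_of_ae_bound (by positivity) ?_
      filter_upwards [(memLp_mul_projIcc hab hc hC g).coeFn_toLp,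
        norm_mul_projIcc_le hab hC g] with x h₁ h₂
      refine (le_of_eq (congrArg norm h₁)).trans (h₂.trans ?_)
      gcongr
      exact le_abs_self C)

theorem coeFn_mulToLp [IsFiniteMeasure μ] {a b : ℝ} (hab : a ≤ b) {c : ℝ → ℝ}
    (hc : AEStronglyMeasurable c μ) {C : ℝ} (hC : ∀ᵐ x ∂μ, ‖c x‖ ≤ C) (g : Icc a b →ᵇ ℝ) :
    mulToLp hab hc hC g =ᵐ[μ] fun x => c x * g (projIcc a b hab x) :=
  (memLp_mul_projIcc hab hc hC g).coeFn_toLp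

/-- Fubini's theorem on the triangle `t ≤ x`. -/
theorem integral_mul_setIntegral_Iic [SFinite μ] [NullSingletonClass μ] {h₁ h₂ : ℝ → ℝ}
    (hh₁ : Integrable h₁ μ) (hh₂ : Integrable h₂ μ) :
    Integrable (fun x => h₁ x * ∫ t in Iic x, h₂ t ∂μ) μ ∧
    Integrable (fun t => h₂ t * ∫ x in Ioi t, h₁ x ∂μ) μ ∧
    ∫ x, h₁ x * (∫ t in Iic x, h₂ t ∂μ) ∂μ = ∫ t, h₂ t * (∫ x in Ioi t, h₁ x ∂μ) ∂μ := by
  have hS : MeasurableSet {p : ℝ × ℝ | p.2 ≤ p.1} := measurableSet_le measurable_snd measurable_fst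
  have hF : Integrable ({p : ℝ × ℝ | p.2 ≤ p.1}.indicator fun p => h₁ p.1 * h₂ p.2) (μ.prod μ) :=
    (hh₁.mul_prod hh₂).indicator hS
  have e₁ : ∀ x, ∫ t, {p : ℝ × ℝ | p.2 ≤ p.1}.indicator (fun p => h₁ p.1 * h₂ p.2) (x, t) ∂μ
      = h₁ x * ∫ t in Iic x, h₂ t ∂μ := by
    intro x
    rw [← integral_const_mul, ← integral_indicator measurableSet_Iic]
    rfl
  have e₂ : ∀ t, ∫ x, {p : ℝ × ℝ | p.2 ≤ p.1}.indicator (fun p => h₁ p.1 * h₂ p.2) (x, t) ∂μ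
      = h₂ t * ∫ x in Ioi t, h₁ x ∂μ := by
    intro t
    rw [← integral_const_mul, ← integral_Ici_eq_integral_Ioi, ← integral_indicator measurableSet_Ici]
    refine integral_congr_ae (ae_of_all _ fun x => ?_)
    by_cases h : t ≤ x <;> simp [indicator, h, mul_comm]
  refine ⟨?_, ?_, ?_⟩
  · simpa only [e₁] using hF.integral_prod_left
  · simpa only [e₂] using hF.integral_prod_right
  · have := integral_integral_swap (f := fun x t =>
      {p : ℝ × ℝ | p.2 ≤ p.1}.indicator (fun p => h₁ p.1 * h₂ p.2) (x, t)) hF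
    simpa only [e₁, e₂] using this

/-- The integral operator with kernel `χ (max x t) * φ (min x t)` is compact and symmetric. -/
theorem exists_green_operator [IsFiniteMeasure μ] [NullSingletonClass μ] {a b : ℝ} (hab : a ≤ b)
    (hμ : ∀ᵐ x ∂μ, x ∈ Icc a b) (hφ : AEStronglyMeasurable φ μ) (hχ : AEStronglyMeasurable χ μ)
    {C : ℝ} (hφC : ∀ᵐ x ∂μ, ‖φ x‖ ≤ C) (hχC : ∀ᵐ x ∂μ, ‖χ x‖ ≤ C) :
    ∃ G : Lp ℝ 2 μ →L[ℝ] Lp ℝ 2 μ, IsCompactOperator G ∧ G.IsSymmetric ∧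
      ∀ f : Lp ℝ 2 μ, G f =ᵐ[μ] fun x =>
        χ x * (∫ t in Iic x, φ t * f t ∂μ) + φ x * ∫ t in Ioi x, χ t * f t ∂μ := by
  have hφ2 : MemLp φ 2 μ := MemLp.of_bound hφ C hφC
  have hχ2 : MemLp χ 2 μ := MemLp.of_bound hχ C hχC
  let κ₁ : C(Icc a b, Lp ℝ 2 μ) :=
    ⟨fun x => cutoff hφ2 x, (continuous_cutoff hφ2).comp continuous_subtype_val⟩
  let κ₂ : C(Icc a b, Lp ℝ 2 μ) :=
    ⟨fun x => hχ2.toLp χ - cutoff hχ2 x,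
      continuous_const.sub ((continuous_cutoff hχ2).comp continuous_subtype_val)⟩
  let G : Lp ℝ 2 μ →L[ℝ] Lp ℝ 2 μ :=
    (mulToLp hab hχ hχC).comp (innerFamily κ₁) + (mulToLp hab hφ hφC).comp (innerFamily κ₂)
  have hG : ∀ f : Lp ℝ 2 μ, G f =ᵐ[μ] fun x =>
      χ x * (∫ t in Iic x, φ t * f t ∂μ) + φ x * ∫ t in Ioi x, χ t * f t ∂μ := by
    intro f
    filter_upwards [Lp.coeFn_add (mulToLp hab hχ hχC (innerFamily κ₁ f))
      (mulToLp hab hφ hφC (innerFamily κ₂ f)), coeFn_mulToLp hab hχ hχC (innerFamily κ₁ f),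
      coeFn_mulToLp hab hφ hφC (innerFamily κ₂ f), hμ] with x h₁ h₂ h₃ hx
    change (mulToLp hab hχ hχC (innerFamily κ₁ f) + mulToLp hab hφ hφC (innerFamily κ₂ f) :
      Lp ℝ 2 μ) x = _
    rw [h₁, Pi.add_apply, h₂, h₃, innerFamily_apply, innerFamily_apply, projIcc_of_mem hab hx]
    have hint : Integrable (fun t => χ t * f t) μ := hχ2.integrable_mul (Lp.memLp f)
    have h4 : ∫ t in Ioi x, χ t * f t ∂μ
        = ∫ t, χ t * f t ∂μ - ∫ t in Iic x, χ t * f t ∂μ := by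
      rw [← integral_add_compl (measurableSet_Iic (a := x)) hint, compl_Iic]
      ring
    congr 2
    · exact inner_cutoff hφ2 x f
    · rw [h4, ← inner_toLp_left hχ2, ← inner_cutoff hχ2]
      exact inner_sub_left _ _ _
  refine ⟨G, ?_, ?_, hG⟩
  · exact ((isCompactOperator_innerFamily κ₁).clm_comp (mulToLp hab hχ hχC)).add
      ((isCompactOperator_innerFamily κ₂).clm_comp (mulToLp hab hφ hφC))
  · intro f g
    have h₁ : ∀ u : Lp ℝ 2 μ, Integrable (fun t => φ t * u t) μ := fun u =>
      hφ2.integrable_mul (Lp.memLp u)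
    have h₂ : ∀ u : Lp ℝ 2 μ, Integrable (fun t => χ t * u t) μ := fun u =>
      hχ2.integrable_mul (Lp.memLp u)
    have key : ∀ u v : Lp ℝ 2 μ, ⟪G u, v⟫_ℝ
        = ∫ x, χ x * v x * (∫ t in Iic x, φ t * u t ∂μ) ∂μ
          + ∫ x, φ x * v x * (∫ t in Ioi x, χ t * u t ∂μ) ∂μ := by
      intro u v
      rw [← integral_add (integral_mul_setIntegral_Iic (h₂ v) (h₁ u)).1
        (integral_mul_setIntegral_Iic (h₂ u) (h₁ v)).2.1, L2.inner_def]
      refine integral_congr_ae ?_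
      filter_upwards [hG u] with x hx
      rw [hx]
      simp only [RCLike.inner_apply, conj_trivial]
      ring
    change ⟪G f, g⟫_ℝ = ⟪f, G g⟫_ℝ
    rw [real_inner_comm (G g) f, key, key, (integral_mul_setIntegral_Iic (h₂ g) (h₁ f)).2.2,
      (integral_mul_setIntegral_Iic (h₂ f) (h₁ g)).2.2, add_comm]

end GreenOperator

/-! ### Variation of parameters on one interval -/

section VariationOfParameters

/- Throughout, `u` and `v` solve the same homogeneous equation with derivatives `u'` and `v'`, `W` is
their constant Wronskian, and the formula in question is `v F + u K`, where
`F x = F₀ + c ∫ₐˣ u f` and `K x = K₀ - c ∫ₐˣ v f`. -/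

variable {k u u' v v' f : ℝ → ℝ} {a b c W F₀ K₀ : ℝ}

theorem IsSolPair.intervalIntegrable_mul (hu : IsSolPair k a b u u')
    (hf : IntervalIntegrable f volume a b) :
    IntervalIntegrable (fun t => u t * f t) volume a b :=
  hf.continuousOn_mul hu.cont_u.continuousOn

theorem IsSolPair.continuousOn_primitive (hab : a ≤ b) (hu : IsSolPair k a b u u')
    (hf : IntervalIntegrable f volume a b) (F₀ c : ℝ) :
    ContinuousOn (fun x => F₀ + c * ∫ t in a..x, u t * f t) (Icc a b) := by
  have := intervalIntegral.continuousOn_primitive_interval' (hu.intervalIntegrable_mul hf)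
    left_mem_uIcc
  rw [uIcc_of_le hab] at this
  fun_prop

/-- If `r f` is equal to the function given by the variation of parameters formula with source `f`,
and `r ≠ 0`, then `f` agrees almost everywhere with a solution of an equation of the same kind. -/
theorem exists_isSolPair_of_variation (hab : a < b)
    (hu : IsSolPair k a b u u') (hv : IsSolPair k a b v v')
    (hW : ∀ x ∈ Icc a b, u x * v' x - u' x * v x = W) (hf : IntervalIntegrable f volume a b)
    {r : ℝ} (hr : r ≠ 0)
    (h : ∀ᵐ x ∂volume.restrict (Icc a b), r * f x =
      v x * (F₀ + c * ∫ t in a..x, u t * f t) + u x * (K₀ + -c * ∫ t in a..x, v t * f t)) :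
    ∃ y z : ℝ → ℝ, IsSolPair (fun x => k x + c * W / r) a b y z ∧
      f =ᵐ[volume.restrict (Icc a b)] y ∧
      ∀ x ∈ Icc a b,
        r * y x = v x * (F₀ + c * ∫ t in a..x, u t * f t)
          + u x * (K₀ + -c * ∫ t in a..x, v t * f t) ∧
        r * z x = v' x * (F₀ + c * ∫ t in a..x, u t * f t)
          + u' x * (K₀ + -c * ∫ t in a..x, v t * f t) := by
  set F : ℝ → ℝ := fun x => F₀ + c * ∫ t in a..x, u t * f t with hF
  set K : ℝ → ℝ := fun x => K₀ + -c * ∫ t in a..x, v t * f t with hK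
  have hFc : ContinuousOn F (Icc a b) := hu.continuousOn_primitive hab.le hf F₀ c
  have hKc : ContinuousOn K (Icc a b) := hv.continuousOn_primitive hab.le hf K₀ (-c)
  have huc := hu.cont_u
  have hvc := hv.cont_u
  have huc' := hu.cont_v
  have hvc' := hv.cont_v
  have hyc : ContinuousOn (fun x => r⁻¹ * (v x * F x + u x * K x)) (Icc a b) := by fun_prop
  -- a continuous representative of `f`, defined on the whole line
  set g : ℝ → ℝ := IccExtend hab.le ((Icc a b).domRestrict
    fun x => r⁻¹ * (v x * F x + u x * K x)) with hg
  have hgc : Continuous g := (continuousOn_iff_continuous_domRestrict.1 hyc).Icc_extend'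
  have hgx : ∀ x ∈ Icc a b, g x = r⁻¹ * (v x * F x + u x * K x) := fun x hx => by
    rw [hg, IccExtend_of_mem _ _ hx]; rfl
  have hfg : f =ᵐ[volume.restrict (Icc a b)] g := by
    filter_upwards [h, ae_restrict_mem measurableSet_Icc] with x hx hxm
    rw [hgx x hxm, ← hx, inv_mul_cancel_left₀ hr]
  have hint : ∀ w : ℝ → ℝ, ∀ x ∈ Icc a b,
      ∫ t in a..x, w t * f t = ∫ t in a..x, w t * g t := by
    intro w x hx
    refine intervalIntegral.integral_congr_ae_restrict ?_
    rw [uIoc_of_le hx.1]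
    filter_upwards [ae_restrict_of_ae_restrict_of_subset
      (Ioc_subset_Icc_self.trans (Icc_subset_Icc_right hx.2)) hfg] with t ht
    rw [ht]
  set F₁ : ℝ → ℝ := fun x => F₀ + c * ∫ t in a..x, u t * g t with hF₁
  set K₁ : ℝ → ℝ := fun x => K₀ + -c * ∫ t in a..x, v t * g t with hK₁
  have hFF : ∀ x ∈ Icc a b, F₁ x = F x := fun x hx => by simp only [hF₁, hF, hint u x hx]
  have hKK : ∀ x ∈ Icc a b, K₁ x = K x := fun x hx => by simp only [hK₁, hK, hint v x hx]
  have hFd : ∀ x, HasDerivAt F₁ (c * (u x * g x)) x := fun x =>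
    (((huc.mul hgc).integral_hasStrictDerivAt a x).hasDerivAt.const_mul c).const_add F₀
  have hKd : ∀ x, HasDerivAt K₁ (-c * (v x * g x)) x := fun x =>
    (((hvc.mul hgc).integral_hasStrictDerivAt a x).hasDerivAt.const_mul (-c)).const_add K₀
  have hF₁c : Continuous F₁ := continuous_iff_continuousAt.2 fun x => (hFd x).continuousAt
  have hK₁c : Continuous K₁ := continuous_iff_continuousAt.2 fun x => (hKd x).continuousAt
  have hyg : ∀ x ∈ Icc a b, r⁻¹ * (v x * F₁ x + u x * K₁ x) = g x := fun x hx => by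
    rw [hFF x hx, hKK x hx, hgx x hx]
  refine ⟨fun x => r⁻¹ * (v x * F₁ x + u x * K₁ x), fun x => r⁻¹ * (v' x * F₁ x + u' x * K₁ x),
    ⟨by fun_prop, by fun_prop, fun x hx => ?_, fun x hx => ?_⟩, ?_, fun x hx => ?_⟩
  · refine ((((hv.deriv_u x hx).mul (hFd x)).add
      ((hu.deriv_u x hx).mul (hKd x))).const_mul r⁻¹).congr_deriv ?_
    ring
  · refine ((((hv.deriv_v x hx).mul (hFd x)).add
      ((hu.deriv_v x hx).mul (hKd x))).const_mul r⁻¹).congr_deriv ?_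
    rw [add_mul (k x), hyg x hx, div_eq_mul_inv, ← hW x hx]
    linear_combination (k x) * hyg x hx
  · filter_upwards [hfg, ae_restrict_mem measurableSet_Icc] with x hx hxm
    rw [hx, hyg x hxm]
  · simp only [hFF x hx, hKK x hx]
    exact ⟨mul_inv_cancel_left₀ hr _, mul_inv_cancel_left₀ hr _⟩

/-- If the function given by the variation of parameters formula vanishes, so does the source. By
Lebesgue's differentiation theorem its derivative has no term in `f`. -/
theorem ae_eq_zero_of_variation_eq_zero (hab : a < b)
    (hu : IsSolPair k a b u u') (hv : IsSolPair k a b v v')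
    (hW : ∀ x ∈ Icc a b, u x * v' x - u' x * v x = W) (hW0 : W ≠ 0) (hc : c ≠ 0)
    (hf : IntervalIntegrable f volume a b)
    (h : ∀ᵐ x ∂volume.restrict (Icc a b),
      v x * (F₀ + c * ∫ t in a..x, u t * f t) + u x * (K₀ + -c * ∫ t in a..x, v t * f t) = 0) :
    f =ᵐ[volume.restrict (Icc a b)] 0 := by
  set F : ℝ → ℝ := fun x => F₀ + c * ∫ t in a..x, u t * f t with hF
  set K : ℝ → ℝ := fun x => K₀ + -c * ∫ t in a..x, v t * f t with hK
  have hFc : ContinuousOn F (Icc a b) := hu.continuousOn_primitive hab.le hf F₀ c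
  have hKc : ContinuousOn K (Icc a b) := hv.continuousOn_primitive hab.le hf K₀ (-c)
  have huc := hu.cont_u
  have hvc := hv.cont_u
  have hy : EqOn (fun x => v x * F x + u x * K x) 0 (Icc a b) :=
    Measure.eqOn_Icc_of_ae_eq volume hab.ne h (by fun_prop) continuousOn_const
  have hd : ∀ᵐ x ∂volume.restrict (Ioo a b),
      HasDerivAt F (c * (u x * f x)) x ∧ HasDerivAt K (-c * (v x * f x)) x := by
    have h₁ := (hu.intervalIntegrable_mul hf).ae_hasDerivAt_integral
    have h₂ := (hv.intervalIntegrable_mul hf).ae_hasDerivAt_integral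
    filter_upwards [ae_restrict_of_ae h₁, ae_restrict_of_ae h₂,
      ae_restrict_mem measurableSet_Ioo] with x hx₁ hx₂ hx
    have hx' : x ∈ uIcc a b := by rw [uIcc_of_le hab.le]; exact Ioo_subset_Icc_self hx
    exact ⟨((hx₁ hx' a left_mem_uIcc).const_mul c).const_add F₀,
      ((hx₂ hx' a left_mem_uIcc).const_mul (-c)).const_add K₀⟩
  have hzero : ∀ {p : ℝ → ℝ} {p' x : ℝ}, EqOn p 0 (Ioo a b) → x ∈ Ioo a b →
      HasDerivAt p p' x → p' = 0 := by
    intro p p' x hp hx hp'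
    refine hp'.unique ((hasDerivAt_const x (0 : ℝ)).congr_of_eventuallyEq ?_)
    filter_upwards [Ioo_mem_nhds hx.1 hx.2] with t ht using hp ht
  -- the formula and its derivative vanish, and the Wronskian is not zero
  have hFK : ∀ᵐ x ∂volume.restrict (Ioo a b), F x = 0 ∧ K x = 0 := by
    filter_upwards [hd, ae_restrict_mem measurableSet_Ioo] with x hx hxm
    have hxm' := Ioo_subset_Icc_self hxm
    have e₁ : v x * F x + u x * K x = 0 := hy hxm'
    have e₂ := hzero (hy.mono Ioo_subset_Icc_self) hxm
      (((hv.deriv_u x hxm').mul hx.1).add ((hu.deriv_u x hxm').mul hx.2))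
    have hWx := hW x hxm'
    constructor
    · refine (mul_eq_zero.1 (?_ : W * F x = 0)).resolve_left hW0
      linear_combination u x * e₂ - u' x * e₁ - F x * hWx
    · refine (mul_eq_zero.1 (?_ : W * K x = 0)).resolve_left hW0
      linear_combination v' x * e₁ - v x * e₂ - K x * hWx
  have hF0 : EqOn F 0 (Ioo a b) := Measure.eqOn_Ioo_of_ae_eq volume (hFK.mono fun x hx => hx.1)
    (hFc.mono Ioo_subset_Icc_self) continuousOn_const
  have hK0 : EqOn K 0 (Ioo a b) := Measure.eqOn_Ioo_of_ae_eq volume (hFK.mono fun x hx => hx.2)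
    (hKc.mono Ioo_subset_Icc_self) continuousOn_const
  rw [← restrict_Ioo_eq_restrict_Icc]
  filter_upwards [hd, ae_restrict_mem measurableSet_Ioo] with x hx hxm
  have e₁ := hzero hF0 hxm hx.1
  have e₂ := hzero hK0 hxm hx.2
  have hWx := hW x (Ioo_subset_Icc_self hxm)
  refine (mul_eq_zero.1 (?_ : c * W * f x = 0)).resolve_left (mul_ne_zero hc hW0)
  linear_combination v' x * e₁ + u' x * e₂ - c * f x * hWx

end VariationOfParameters

/-! ### Solutions of the two-interval equation -/

namespace TwoIntervalSL

theorem hasDerivWithinAt_clm_comp {𝕜 𝕜' : Type*} [RCLike 𝕜] [RCLike 𝕜'] (L : 𝕜 →L[ℝ] 𝕜')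
    {y : ℝ → 𝕜} {d : 𝕜} {s : Set ℝ} {x : ℝ} (h : HasDerivWithinAt y d s x) :
    HasDerivWithinAt (fun t => L (y t)) (L d) s x :=
  L.hasFDerivAt.comp_hasDerivWithinAt x h

/-- Real-linear maps preserve solutions for a real eigenparameter. This covers real and imaginary
parts of complex solutions as well as complexifications of real ones. -/
theorem SolvesOn.clm_comp {𝕜 𝕜' : Type*} [RCLike 𝕜] [RCLike 𝕜'] (L : 𝕜 →L[ℝ] 𝕜') {p lam : ℝ}
    {q : ℝ → ℝ} {I : Set ℝ} {y dy : ℝ → 𝕜} (h : SolvesOn p q (lam : 𝕜) I y dy) :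
    SolvesOn p q (lam : 𝕜') I (fun x => L (y x)) (fun x => L (dy x)) := by
  intro x hx
  obtain ⟨h₁, d, h₂, h₃⟩ := h x hx
  refine ⟨hasDerivWithinAt_clm_comp L h₁, L d, hasDerivWithinAt_clm_comp L h₂, ?_⟩
  have := congrArg L h₃
  rw [← RCLike.real_smul_eq_coe_mul] at this ⊢
  simpa using this

theorem SatisfiesBTC.clm_comp {𝕜 𝕜' : Type*} [RCLike 𝕜] [RCLike 𝕜'] (L : 𝕜 →L[ℝ] 𝕜')
    {P : TwoIntervalSL} {y dy : ℝ → 𝕜} (h : P.SatisfiesBTC y dy) :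
    P.SatisfiesBTC (fun x => L (y x)) (fun x => L (dy x)) := by
  obtain ⟨h₁, h₂, a₀, a₁, b₀, b₁, ⟨t₁, t₂, t₃, t₄⟩, h₃⟩ := h
  refine ⟨by simpa using congrArg L h₁, by simpa using congrArg L h₂, L a₀, L a₁, L b₀, L b₁,
    ⟨(L.continuous.tendsto _).comp t₁, (L.continuous.tendsto _).comp t₂,
      (L.continuous.tendsto _).comp t₃, (L.continuous.tendsto _).comp t₄⟩,
    fun i => by simpa using congrArg L (h₃ i)⟩

/-- The Plücker relation between the minors of a `2 × 4` matrix. -/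
theorem minor_relation (P : TwoIntervalSL) :
    P.Δ₁₃ * P.Δ₂₄ - P.Δ₁₄ * P.Δ₂₃ = P.Δ₁₂ * P.Δ₃₄ := by
  simp only [Δ₁₃, Δ₂₄, Δ₁₄, Δ₂₃, Δ₁₂, Δ₃₄, minor]
  ring

/-- Continuous functions on the line that agree with the potential to the left and to the right
of `0`. -/
structure PotentialExtension (P : TwoIntervalSL) where
  qL : ℝ → ℝ
  qR : ℝ → ℝ
  cont_left : Continuous qL
  cont_right : Continuous qR
  eq_left : EqOn P.q qL (Ico (-π) 0)
  eq_right : EqOn P.q qR (Ioc 0 π)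

/-- A function with a finite limit at the point `c` that is removed from its compact interval of
definition is the restriction of a continuous function on the line. -/
theorem exists_continuous_eqOn {q : ℝ → ℝ} {a b c l : ℝ} (hab : a ≤ b)
    (hq : ContinuousOn q (Icc a b \ {c}))
    (hl : Tendsto q (𝓝[Icc a b \ {c}] c) (𝓝 l)) :
    ∃ q' : ℝ → ℝ, Continuous q' ∧ EqOn q q' (Icc a b \ {c}) := by
  have h : ContinuousOn (Function.update q c l) (Icc a b) :=
    continuousOn_update_iff.2 ⟨hq, fun _ => hl⟩
  refine ⟨IccExtend hab ((Icc a b).domRestrict (Function.update q c l)),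
    (continuousOn_iff_continuous_domRestrict.1 h).Icc_extend', fun x hx => ?_⟩
  rw [IccExtend_of_mem _ _ hx.1]
  exact (Function.update_of_ne hx.2 l q).symm

theorem PotentialRegular.nonempty_extension {P : TwoIntervalSL} (hq : P.PotentialRegular) :
    Nonempty P.PotentialExtension := by
  obtain ⟨h₁, h₂, ⟨l, hl⟩, r, hr⟩ := hq
  have hL : Icc (-π) 0 \ {0} = Ico (-π) 0 := Icc_sdiff_right
  have hR : Icc 0 π \ {0} = Ioc 0 π := Icc_sdiff_left
  obtain ⟨qL, cL, eL⟩ := exists_continuous_eqOn (q := P.q) (a := -π) (b := 0) (c := 0) (l := l)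
    (by linarith [pi_pos]) (by rwa [hL])
    (by rw [hL]; exact hl.mono_left (nhdsWithin_mono _ Ico_subset_Iio_self))
  obtain ⟨qR, cR, eR⟩ := exists_continuous_eqOn (q := P.q) (a := 0) (b := π) (c := 0) (l := r)
    pi_pos.le (by rwa [hR])
    (by rw [hR]; exact hr.mono_left (nhdsWithin_mono _ Ioc_subset_Ioi_self))
  exact ⟨⟨qL, qR, cL, cR, hL ▸ eL, hR ▸ eR⟩⟩

theorem SolvesOn.exists_isSolPair {p lam : ℝ} (hp : p ≠ 0) {q q' : ℝ → ℝ} {s : Set ℝ} {a b x₀ : ℝ}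
    (hq' : Continuous q') (hqq : EqOn q q' s) (hs : Convex ℝ s) (hsab : s ⊆ Icc a b) (hx₀ : x₀ ∈ s)
    {y dy : ℝ → ℝ} (h : SolvesOn p q lam s y dy) :
    ∃ u v, IsSolPair (fun x => (q' x - lam) / p) a b u v ∧ EqOn y u s ∧ EqOn dy v s := by
  have hk : Continuous fun x => (q' x - lam) / p := by fun_prop
  obtain ⟨u, v, huv, hu, hv⟩ := _root_.exists_isSolPair hk (hsab hx₀) (y x₀) (dy x₀)
  have key : ∀ x ∈ s, y x - u x = 0 ∧ dy x - v x = 0 := fun x hx =>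
    eq_zero_of_initial_zero hk hs hsab (D := fun t => y t - u t) (E := fun t => dy t - v t)
      (fun t ht => (h t ht).1.sub (huv.deriv_u t (hsab ht)).hasDerivWithinAt)
      (fun t ht => by
        obtain ⟨-, d, h₂, h₃⟩ := h t ht
        refine (h₂.sub (huv.deriv_v t (hsab ht)).hasDerivWithinAt).congr_deriv ?_
        rw [hqq ht] at h₃
        simp only [smul_eq_mul] at h₃
        field_simp
        linear_combination -h₃)
      hx₀ (by simp [hu]) (by simp [hv]) hx
  exact ⟨u, v, huv, fun x hx => sub_eq_zero.1 (key x hx).1, fun x hx => sub_eq_zero.1 (key x hx).2⟩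

theorem SolvesOn.of_isSolPair {p lam : ℝ} (hp : p ≠ 0) {q q' : ℝ → ℝ} {s : Set ℝ} {a b : ℝ}
    (hqq : EqOn q q' s) (hsab : s ⊆ Icc a b) {u v y dy : ℝ → ℝ}
    (h : IsSolPair (fun x => (q' x - lam) / p) a b u v) (hy : EqOn y u s) (hdy : EqOn dy v s) :
    SolvesOn p q lam s y dy := by
  intro x hx
  rw [hdy hx, hy hx]
  refine ⟨(h.deriv_u x (hsab hx)).hasDerivWithinAt.congr hy (hy hx), _,
    (h.deriv_v x (hsab hx)).hasDerivWithinAt.congr hdy (hdy hx), ?_⟩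
  rw [hqq hx]
  simp only [smul_eq_mul]
  field_simp
  ring

/-- A real solution on the two closed intervals, each part continued past `0`, that satisfies the
transmission conditions, solved for the values at `0+`. -/
structure Sol (P : TwoIntervalSL) (Q : P.PotentialExtension) (lam : ℝ) where
  uL : ℝ → ℝ
  vL : ℝ → ℝ
  uR : ℝ → ℝ
  vR : ℝ → ℝ
  left : IsSolPair (fun x => (Q.qL x - lam) / P.p₁) (-π) 0 uL vL
  right : IsSolPair (fun x => (Q.qR x - lam) / P.p₂) 0 π uR vR
  trans₀ : uR 0 = 1 / P.Δ₁₂ * (P.Δ₂₃ * uL 0 + P.Δ₂₄ * vL 0)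
  trans₁ : vR 0 = -1 / P.Δ₁₂ * (P.Δ₁₃ * uL 0 + P.Δ₁₄ * vL 0)

variable {P : TwoIntervalSL} {Q : P.PotentialExtension} {lam lam' : ℝ}

namespace Sol

/-- The solution as one function; its value at `0` is the left limit. -/
def fn (s : Sol P Q lam) (x : ℝ) : ℝ := if x ≤ 0 then s.uL x else s.uR x

/-- The derivative of `Sol.fn` away from `0`. -/
def dfn (s : Sol P Q lam) (x : ℝ) : ℝ := if x ≤ 0 then s.vL x else s.vR x

/-- The left boundary condition. -/
def BCLeft (s : Sol P Q lam) : Prop := cos P.α * s.uL (-π) + sin P.α * s.vL (-π) = 0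

/-- The right boundary condition. -/
def BCRight (s : Sol P Q lam) : Prop := cos P.β * s.uR π + sin P.β * s.vR π = 0

/-- The normalization at `-π` that characterizes `φ`. -/
def InitLeft (s : Sol P Q lam) : Prop := s.uL (-π) = sin P.α ∧ s.vL (-π) = -cos P.α

theorem InitLeft.bcLeft {s : Sol P Q lam} (h : s.InitLeft) : s.BCLeft := by
  rw [BCLeft, h.1, h.2]; ring

theorem zero_mem_left : (0 : ℝ) ∈ Icc (-π) 0 := ⟨by linarith [pi_pos], le_rfl⟩
theorem neg_pi_mem_left : -π ∈ Icc (-π) 0 := ⟨le_rfl, by linarith [pi_pos]⟩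
theorem zero_mem_right : (0 : ℝ) ∈ Icc 0 π := ⟨le_rfl, pi_pos.le⟩
theorem pi_mem_right : π ∈ Icc 0 π := ⟨pi_pos.le, le_rfl⟩

theorem fn_eqOn_left (s : Sol P Q lam) : EqOn s.fn s.uL (Iic 0) := fun _ hx => if_pos hx
theorem dfn_eqOn_left (s : Sol P Q lam) : EqOn s.dfn s.vL (Iic 0) := fun _ hx => if_pos hx
theorem fn_eqOn_right (s : Sol P Q lam) : EqOn s.fn s.uR (Ioi 0) := fun _ hx => if_neg (not_le.2 hx)
theorem dfn_eqOn_right (s : Sol P Q lam) : EqOn s.dfn s.vR (Ioi 0) :=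
  fun _ hx => if_neg (not_le.2 hx)

theorem exists_initLeft (P : TwoIntervalSL) (Q : P.PotentialExtension) (lam : ℝ) :
    ∃ s : Sol P Q lam, s.InitLeft := by
  have hL : Continuous fun x => (Q.qL x - lam) / P.p₁ := by have := Q.cont_left; fun_prop
  have hR : Continuous fun x => (Q.qR x - lam) / P.p₂ := by have := Q.cont_right; fun_prop
  obtain ⟨uL, vL, h₁, h₂, h₃⟩ := exists_isSolPair hL neg_pi_mem_left (sin P.α) (-cos P.α)
  obtain ⟨uR, vR, h₄, h₅, h₆⟩ := exists_isSolPair hR zero_mem_right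
    (1 / P.Δ₁₂ * (P.Δ₂₃ * uL 0 + P.Δ₂₄ * vL 0)) (-1 / P.Δ₁₂ * (P.Δ₁₃ * uL 0 + P.Δ₁₄ * vL 0))
  exact ⟨⟨uL, vL, uR, vR, h₁, h₄, h₅, h₆⟩, h₂, h₃⟩

theorem exists_initRight (Q : P.PotentialExtension) (lam : ℝ) (h₁₂ : P.Δ₁₂ ≠ 0) (h₃₄ : P.Δ₃₄ ≠ 0) :
    ∃ s : Sol P Q lam, s.uR π = sin P.β ∧ s.vR π = -cos P.β := by
  have hL : Continuous fun x => (Q.qL x - lam) / P.p₁ := by have := Q.cont_left; fun_prop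
  have hR : Continuous fun x => (Q.qR x - lam) / P.p₂ := by have := Q.cont_right; fun_prop
  obtain ⟨uR, vR, h₁, h₂, h₃⟩ := exists_isSolPair hR pi_mem_right (sin P.β) (-cos P.β)
  obtain ⟨uL, vL, h₄, h₅, h₆⟩ := exists_isSolPair hL zero_mem_left
    (-1 / P.Δ₃₄ * (P.Δ₁₄ * uR 0 + P.Δ₂₄ * vR 0)) (1 / P.Δ₃₄ * (P.Δ₁₃ * uR 0 + P.Δ₂₃ * vR 0))
  have hm := P.minor_relation
  refine ⟨⟨uL, vL, uR, vR, h₄, h₁, ?_, ?_⟩, h₂, h₃⟩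
  · rw [h₅, h₆]
    field_simp
    linear_combination -uR 0 * hm
  · rw [h₅, h₆]
    field_simp
    linear_combination -vR 0 * hm

/-- The transmission conditions multiply the Wronskian by `Δ₃₄ / Δ₁₂`. -/
theorem wronskian_zero (h₁₂ : P.Δ₁₂ ≠ 0) (s : Sol P Q lam) (t : Sol P Q lam') :
    P.Δ₁₂ * (s.uR 0 * t.vR 0 - s.vR 0 * t.uR 0)
      = P.Δ₃₄ * (s.uL 0 * t.vL 0 - s.vL 0 * t.uL 0) := by
  rw [s.trans₀, s.trans₁, t.trans₀, t.trans₁]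
  field_simp
  linear_combination (s.uL 0 * t.vL 0 - s.vL 0 * t.uL 0) * P.minor_relation

/-- A solution is determined by its initial values at `-π`. -/
theorem eq_const_mul (s t : Sol P Q lam) {c : ℝ} (h₀ : s.uL (-π) = c * t.uL (-π))
    (h₁ : s.vL (-π) = c * t.vL (-π)) :
    (∀ x ∈ Icc (-π) 0, s.uL x = c * t.uL x ∧ s.vL x = c * t.vL x) ∧
      ∀ x ∈ Icc 0 π, s.uR x = c * t.uR x ∧ s.vR x = c * t.vR x := by
  have hL : Continuous fun x => (Q.qL x - lam) / P.p₁ := by have := Q.cont_left; fun_prop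
  have hR : Continuous fun x => (Q.qR x - lam) / P.p₂ := by have := Q.cont_right; fun_prop
  have hl : ∀ x ∈ Icc (-π) 0, s.uL x = c * t.uL x ∧ s.vL x = c * t.vL x := fun x hx =>
    s.left.eq_of_initial_eq hL (t.left.const_mul c) neg_pi_mem_left h₀ h₁ hx
  refine ⟨hl, fun x hx => s.right.eq_of_initial_eq hR (t.right.const_mul c) zero_mem_right ?_ ?_ hx⟩
  · rw [s.trans₀, t.trans₀, (hl 0 zero_mem_left).1, (hl 0 zero_mem_left).2]; ring
  · rw [s.trans₁, t.trans₁, (hl 0 zero_mem_left).1, (hl 0 zero_mem_left).2]; ring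

/-- The left boundary condition determines a solution up to a factor. -/
theorem BCLeft.exists_eq_const_mul {s t : Sol P Q lam} (hs : s.BCLeft) (ht : t.InitLeft) :
    ∃ c : ℝ, (∀ x ∈ Icc (-π) 0, s.uL x = c * t.uL x ∧ s.vL x = c * t.vL x) ∧
      ∀ x ∈ Icc 0 π, s.uR x = c * t.uR x ∧ s.vR x = c * t.vR x := by
  refine ⟨s.uL (-π) * sin P.α - s.vL (-π) * cos P.α, s.eq_const_mul t ?_ ?_⟩
  · rw [ht.1]
    rw [BCLeft] at hs
    linear_combination cos P.α * hs - s.uL (-π) * sin_sq_add_cos_sq P.α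
  · rw [ht.2]
    rw [BCLeft] at hs
    linear_combination sin P.α * hs - s.vL (-π) * sin_sq_add_cos_sq P.α

theorem InitLeft.exists_ne_zero {s : Sol P Q lam} (hs : s.InitLeft) :
    ∃ x ∈ Ico (-π) 0, s.uL x ≠ 0 := by
  by_contra! h
  have hmem : -π ∈ Ico (-π) 0 := ⟨le_rfl, by linarith [pi_pos]⟩
  have h₀ := h (-π) hmem
  have h₁ : s.vL (-π) = 0 := by
    have hd := (s.left.deriv_u (-π) neg_pi_mem_left).hasDerivWithinAt (s := Ico (-π) 0)
    have hd' : HasDerivWithinAt s.uL 0 (Ico (-π) 0) (-π) :=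
      (hasDerivWithinAt_const (-π) (Ico (-π) 0) (0 : ℝ)).congr h h₀
    exact (uniqueDiffOn_Ico (-π) 0 (-π) hmem).eq_deriv _ hd hd'
  rw [hs.1] at h₀
  rw [hs.2, neg_eq_zero] at h₁
  have := sin_sq_add_cos_sq P.α
  simp [h₀, h₁] at this

theorem tendsto_zero_left {y u : ℝ → ℝ} (hu : Continuous u) (h : EqOn y u (Ico (-π) 0)) :
    Tendsto y (𝓝[<] 0) (𝓝 (u 0)) := by
  refine ((hu.tendsto 0).mono_left nhdsWithin_le_nhds).congr' ?_
  filter_upwards [Ico_mem_nhdsLT (show -π < 0 by linarith [pi_pos])] with x hx using (h hx).symm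

theorem tendsto_zero_right {y u : ℝ → ℝ} (hu : Continuous u) (h : EqOn y u (Ioc 0 π)) :
    Tendsto y (𝓝[>] 0) (𝓝 (u 0)) := by
  refine ((hu.tendsto 0).mono_left nhdsWithin_le_nhds).congr' ?_
  filter_upwards [Ioc_mem_nhdsGT pi_pos] with x hx using (h hx).symm

theorem fn_eqOn_Ico (s : Sol P Q lam) : EqOn s.fn s.uL (Ico (-π) 0) :=
  s.fn_eqOn_left.mono fun _ hx => hx.2.le
theorem dfn_eqOn_Ico (s : Sol P Q lam) : EqOn s.dfn s.vL (Ico (-π) 0) :=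
  s.dfn_eqOn_left.mono fun _ hx => hx.2.le
theorem fn_eqOn_Ioc (s : Sol P Q lam) : EqOn s.fn s.uR (Ioc 0 π) :=
  s.fn_eqOn_right.mono fun _ hx => hx.1
theorem dfn_eqOn_Ioc (s : Sol P Q lam) : EqOn s.dfn s.vR (Ioc 0 π) :=
  s.dfn_eqOn_right.mono fun _ hx => hx.1

theorem isSolution (hp₁ : P.p₁ ≠ 0) (hp₂ : P.p₂ ≠ 0) (s : Sol P Q lam) :
    P.IsSolution lam s.fn s.dfn :=
  ⟨.of_isSolPair hp₁ Q.eq_left Ico_subset_Icc_self s.left s.fn_eqOn_Ico s.dfn_eqOn_Ico,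
    .of_isSolPair hp₂ Q.eq_right Ioc_subset_Icc_self s.right s.fn_eqOn_Ioc s.dfn_eqOn_Ioc⟩

theorem hasTraces (s : Sol P Q lam) : HasTraces s.fn s.dfn (s.uL 0) (s.vL 0) (s.uR 0) (s.vR 0) :=
  ⟨tendsto_zero_left s.left.cont_u s.fn_eqOn_Ico, tendsto_zero_left s.left.cont_v s.dfn_eqOn_Ico,
    tendsto_zero_right s.right.cont_u s.fn_eqOn_Ioc,
    tendsto_zero_right s.right.cont_v s.dfn_eqOn_Ioc⟩

end Sol

/-- Cramer's rule for the transmission conditions. -/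
theorem transmission_iff (h₁₂ : P.Δ₁₂ ≠ 0) {a₀ a₁ b₀ b₁ : ℝ} :
    (∀ i : Fin 2, P.bm i 1 • a₁ + P.bm i 0 • a₀ + P.bp i 1 • b₁ + P.bp i 0 • b₀ = 0) ↔
      b₀ = 1 / P.Δ₁₂ * (P.Δ₂₃ * a₀ + P.Δ₂₄ * a₁) ∧
      b₁ = -1 / P.Δ₁₂ * (P.Δ₁₃ * a₀ + P.Δ₁₄ * a₁) := by
  have e₁₂ : P.Δ₁₂ = P.bp 0 0 * P.bp 1 1 - P.bp 0 1 * P.bp 1 0 := rfl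
  have e₁₃ : P.Δ₁₃ = P.bp 0 0 * P.bm 1 0 - P.bm 0 0 * P.bp 1 0 := rfl
  have e₁₄ : P.Δ₁₄ = P.bp 0 0 * P.bm 1 1 - P.bm 0 1 * P.bp 1 0 := rfl
  have e₂₃ : P.Δ₂₃ = P.bp 0 1 * P.bm 1 0 - P.bm 0 0 * P.bp 1 1 := rfl
  have e₂₄ : P.Δ₂₄ = P.bp 0 1 * P.bm 1 1 - P.bm 0 1 * P.bp 1 1 := rfl
  rw [Fin.forall_fin_two]
  simp only [smul_eq_mul]
  constructor
  · rintro ⟨h₀, h₁⟩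
    constructor
    · field_simp
      rw [e₁₂, e₂₃, e₂₄]
      linear_combination P.bp 1 1 * h₀ - P.bp 0 1 * h₁
    · field_simp
      rw [e₁₂, e₁₃, e₁₄]
      linear_combination P.bp 0 0 * h₁ - P.bp 1 0 * h₀
  · rintro ⟨h₀, h₁⟩
    have h₀' : P.Δ₁₂ * b₀ = P.Δ₂₃ * a₀ + P.Δ₂₄ * a₁ := by rw [h₀]; field_simp
    have h₁' : P.Δ₁₂ * b₁ = -(P.Δ₁₃ * a₀ + P.Δ₁₄ * a₁) := by rw [h₁]; field_simp
    constructor <;> refine (mul_eq_zero.1 (?_ : P.Δ₁₂ * _ = 0)).resolve_left h₁₂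
    · have := e₁₂
      linear_combination P.bp 0 0 * h₀' + P.bp 0 1 * h₁' + P.bp 0 0 * a₀ * e₂₃
        + P.bp 0 0 * a₁ * e₂₄ - P.bp 0 1 * a₀ * e₁₃ - P.bp 0 1 * a₁ * e₁₄
        + (P.bm 0 1 * a₁ + P.bm 0 0 * a₀) * e₁₂
    · linear_combination P.bp 1 0 * h₀' + P.bp 1 1 * h₁' + P.bp 1 0 * a₀ * e₂₃
        + P.bp 1 0 * a₁ * e₂₄ - P.bp 1 1 * a₀ * e₁₃ - P.bp 1 1 * a₁ * e₁₄
        + (P.bm 1 1 * a₁ + P.bm 1 0 * a₀) * e₁₂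

/-- A solution in the sense of the problem, given on the half-open intervals, extends to the closed
ones; its one-sided limits at `0` are then values. -/
theorem exists_sol_of_isSolution (hp₁ : P.p₁ ≠ 0) (hp₂ : P.p₂ ≠ 0) (Q : P.PotentialExtension)
    {y dy : ℝ → ℝ} (h : P.IsSolution lam y dy) {a₀ a₁ b₀ b₁ : ℝ}
    (ht : HasTraces y dy a₀ a₁ b₀ b₁) (hb₀ : b₀ = 1 / P.Δ₁₂ * (P.Δ₂₃ * a₀ + P.Δ₂₄ * a₁))
    (hb₁ : b₁ = -1 / P.Δ₁₂ * (P.Δ₁₃ * a₀ + P.Δ₁₄ * a₁)) :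
    ∃ s : Sol P Q lam, EqOn y s.uL (Ico (-π) 0) ∧ EqOn dy s.vL (Ico (-π) 0) ∧
      EqOn y s.uR (Ioc 0 π) ∧ EqOn dy s.vR (Ioc 0 π) := by
  obtain ⟨uL, vL, h₁, h₂, h₃⟩ := h.1.exists_isSolPair hp₁ Q.cont_left Q.eq_left (convex_Ico _ _)
    Ico_subset_Icc_self (x₀ := -π) ⟨le_rfl, by linarith [pi_pos]⟩
  obtain ⟨uR, vR, h₄, h₅, h₆⟩ := h.2.exists_isSolPair hp₂ Q.cont_right Q.eq_right (convex_Ioc _ _)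
    Ioc_subset_Icc_self (x₀ := π) ⟨pi_pos, le_rfl⟩
  obtain ⟨t₁, t₂, t₃, t₄⟩ := ht
  have e₁ := tendsto_nhds_unique t₁ (Sol.tendsto_zero_left h₁.cont_u h₂)
  have e₂ := tendsto_nhds_unique t₂ (Sol.tendsto_zero_left h₁.cont_v h₃)
  have e₃ := tendsto_nhds_unique t₃ (Sol.tendsto_zero_right h₄.cont_u h₅)
  have e₄ := tendsto_nhds_unique t₄ (Sol.tendsto_zero_right h₄.cont_v h₆)
  exact ⟨⟨uL, vL, uR, vR, h₁, h₄, by rw [← e₁, ← e₂, ← e₃, hb₀], by rw [← e₁, ← e₂, ← e₄, hb₁]⟩,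
    h₂, h₃, h₅, h₆⟩

theorem IsPhi.exists_sol (hp₁ : P.p₁ ≠ 0) (hp₂ : P.p₂ ≠ 0) (Q : P.PotentialExtension) {u : ℝ → ℝ}
    (h : P.IsPhi lam u) :
    ∃ s : Sol P Q lam, s.InitLeft ∧ EqOn u s.uL (Ico (-π) 0) ∧ EqOn u s.uR (Ioc 0 π) := by
  obtain ⟨du, h₁, h₂, h₃, a₀, a₁, b₀, b₁, h₄, h₅, h₆⟩ := h
  obtain ⟨s, e₁, e₂, e₃, -⟩ := exists_sol_of_isSolution hp₁ hp₂ Q h₁ h₄ h₅ h₆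
  have hmem : -π ∈ Ico (-π) 0 := ⟨le_rfl, by linarith [pi_pos]⟩
  exact ⟨s, ⟨by rw [← e₁ hmem, h₂]; simp, by rw [← e₂ hmem, h₃]; simp⟩, e₁, e₃⟩

theorem Sol.isPhi (hp₁ : P.p₁ ≠ 0) (hp₂ : P.p₂ ≠ 0) {s : Sol P Q lam} (hs : s.InitLeft) :
    P.IsPhi lam s.fn := by
  have hmem : -π ∈ Ico (-π) 0 := ⟨le_rfl, by linarith [pi_pos]⟩
  exact ⟨s.dfn, s.isSolution hp₁ hp₂, by rw [s.fn_eqOn_Ico hmem, hs.1]; simp,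
    by rw [s.dfn_eqOn_Ico hmem, hs.2]; simp, _, _, _, _, s.hasTraces, s.trans₀, s.trans₁⟩

theorem Sol.isEigenvalue (hp₁ : P.p₁ ≠ 0) (hp₂ : P.p₂ ≠ 0) (h₁₂ : P.Δ₁₂ ≠ 0) (s : Sol P Q lam)
    (hl : s.BCLeft) (hr : s.BCRight) (h0 : ∃ x ∈ Ico (-π) 0 ∪ Ioc 0 π, s.fn x ≠ 0) :
    P.IsEigenvalue lam := by
  have hmem : -π ∈ Ico (-π) 0 := ⟨le_rfl, by linarith [pi_pos]⟩
  have hmem' : π ∈ Ioc 0 π := ⟨pi_pos, le_rfl⟩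
  have hsol := s.isSolution hp₁ hp₂
  have hbtc : P.SatisfiesBTC s.fn s.dfn :=
    ⟨by rw [s.fn_eqOn_Ico hmem, s.dfn_eqOn_Ico hmem]; exact hl,
      by rw [s.fn_eqOn_Ioc hmem', s.dfn_eqOn_Ioc hmem']; exact hr,
      _, _, _, _, s.hasTraces, (transmission_iff h₁₂).2 ⟨s.trans₀, s.trans₁⟩⟩
  obtain ⟨x, hx, hx0⟩ := h0
  exact ⟨_, _, ⟨hsol.1.clm_comp Complex.ofRealCLM, hsol.2.clm_comp Complex.ofRealCLM⟩,
    hbtc.clm_comp Complex.ofRealCLM, x, hx, by simpa using hx0⟩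

/-- A real eigenvalue has a real eigenfunction, hence a multiple of `φ` satisfies the right
boundary condition. -/
theorem IsEigenvalue.bcRight (hp₁ : P.p₁ ≠ 0) (hp₂ : P.p₂ ≠ 0) (h₁₂ : P.Δ₁₂ ≠ 0)
    (h : P.IsEigenvalue lam) {t : Sol P Q lam} (ht : t.InitLeft) : t.BCRight := by
  obtain ⟨y, dy, hsol, hbtc, x, hx, hx0⟩ := h
  obtain ⟨L, hL⟩ : ∃ L : ℂ →L[ℝ] ℝ, L (y x) ≠ 0 := by
    -- the real or the imaginary part is nontrivial
    by_contra! h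
    exact hx0 (Complex.ext (h Complex.reCLM) (h Complex.imCLM))
  obtain ⟨h₁, h₂, a₀, a₁, b₀, b₁, ht', hT⟩ := hbtc.clm_comp L
  obtain ⟨hb₀, hb₁⟩ := (transmission_iff h₁₂).1 hT
  obtain ⟨s, e₁, e₂, e₃, e₄⟩ := exists_sol_of_isSolution (lam := lam) hp₁ hp₂ Q
    ⟨hsol.1.clm_comp L, hsol.2.clm_comp L⟩ ht' hb₀ hb₁
  have hmem : -π ∈ Ico (-π) 0 := ⟨le_rfl, by linarith [pi_pos]⟩
  have hmem' : π ∈ Ioc 0 π := ⟨pi_pos, le_rfl⟩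
  have hsl : s.BCLeft := by
    rw [Sol.BCLeft, ← e₁ hmem, ← e₂ hmem]; exact h₁
  have hsr : s.BCRight := by
    rw [Sol.BCRight, ← e₃ hmem', ← e₄ hmem']; exact h₂
  obtain ⟨c, hcl, hcr⟩ := hsl.exists_eq_const_mul ht
  have hc : c ≠ 0 := by
    rintro rfl
    refine hL ?_
    rcases hx with hx | hx
    · have := (hcl x (Ico_subset_Icc_self hx)).1
      rw [← e₁ hx] at this
      simpa using this
    · have := (hcr x (Ioc_subset_Icc_self hx)).1
      rw [← e₃ hx] at this
      simpa using this
  rw [Sol.BCRight, (hcr π Sol.pi_mem_right).1, (hcr π Sol.pi_mem_right).2] at hsr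
  refine (mul_eq_zero.1 (?_ : c * _ = 0)).resolve_left hc
  linear_combination hsr

end TwoIntervalSL

/-! ### The eigenvalues are real -/

namespace TwoIntervalSL

/-- The imaginary part of `conj (y x) * dy x`. -/
def imWronskian (y dy : ℝ → ℂ) (x : ℝ) : ℝ := (y x).re * (dy x).im - (dy x).re * (y x).im

/-- The factor `-z.im` makes the derivative nonnegative, whatever the sign of `z.im`. -/
theorem SolvesOn.hasDerivWithinAt_imWronskian {p : ℝ} (hp : p ≠ 0) {q : ℝ → ℝ} {z : ℂ} {s : Set ℝ}
    {y dy : ℝ → ℂ} (h : SolvesOn p q z s y dy) {x : ℝ} (hx : x ∈ s) :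
    HasDerivWithinAt (fun t => -z.im * imWronskian y dy t)
      (z.im ^ 2 / p * Complex.normSq (y x)) s x := by
  obtain ⟨h₁, d, h₂, h₃⟩ := h x hx
  have hre := hasDerivWithinAt_clm_comp Complex.reCLM h₁
  have him := hasDerivWithinAt_clm_comp Complex.imCLM h₁
  have hre' := hasDerivWithinAt_clm_comp Complex.reCLM h₂
  have him' := hasDerivWithinAt_clm_comp Complex.imCLM h₂
  have e₁ := congrArg Complex.re h₃
  have e₂ := congrArg Complex.im h₃
  simp only [Complex.real_smul, Complex.add_re, Complex.neg_re, Complex.mul_re, Complex.ofReal_re,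
    Complex.ofReal_im, zero_mul, sub_zero, Complex.add_im, Complex.neg_im, Complex.mul_im,
    add_zero] at e₁ e₂
  refine (((hre.mul him').sub (hre'.mul him)).const_mul (-z.im)).congr_deriv ?_
  simp only [Complex.reCLM_apply, Complex.imCLM_apply, Complex.normSq_apply]
  field_simp
  linear_combination z.im * ((y x).re * e₂ - (y x).im * e₁)

theorem monotoneOn_imWronskian {p : ℝ} (hp : 0 < p) {q : ℝ → ℝ} {z : ℂ} {s : Set ℝ}
    (hs : Convex ℝ s) {y dy : ℝ → ℂ} (h : SolvesOn p q z s y dy) :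
    MonotoneOn (fun t => -z.im * imWronskian y dy t) s :=
  monotoneOn_of_hasDerivWithinAt_nonneg hs
    (fun _ hx => (h.hasDerivWithinAt_imWronskian hp.ne' hx).continuousWithinAt)
    (fun _ hx => (h.hasDerivWithinAt_imWronskian hp.ne' (interior_subset hx)).mono interior_subset)
    (fun _ _ => mul_nonneg (div_nonneg (sq_nonneg _) hp.le) (Complex.normSq_nonneg _))

theorem SolvesOn.eq_zero_of_imWronskian_eq_zero {p : ℝ} (hp : p ≠ 0) {q : ℝ → ℝ} {z : ℂ}
    (hz : z.im ≠ 0) {s : Set ℝ} (hs : UniqueDiffOn ℝ s) {y dy : ℝ → ℂ} (h : SolvesOn p q z s y dy)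
    (h0 : ∀ x ∈ s, -z.im * imWronskian y dy x = 0) {x : ℝ} (hx : x ∈ s) : y x = 0 := by
  have h₁ := h.hasDerivWithinAt_imWronskian hp hx
  have h₂ : HasDerivWithinAt (fun t => -z.im * imWronskian y dy t) 0 s x :=
    (hasDerivWithinAt_const x s (0 : ℝ)).congr h0 (h0 x hx)
  have h₃ := (hs x hx).eq_deriv _ h₁ h₂
  simpa [hz, hp] using h₃

/-- A real boundary condition makes `y x` and `dy x` real multiples of one complex number. -/
theorem imWronskian_eq_zero_of_boundary {θ : ℝ} {y dy : ℝ → ℂ} {x : ℝ}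
    (h : cos θ • y x + sin θ • dy x = 0) : imWronskian y dy x = 0 := by
  have e₁ := congrArg Complex.re h
  have e₂ := congrArg Complex.im h
  simp only [Complex.add_re, Complex.add_im, Complex.smul_re, Complex.smul_im, smul_eq_mul,
    Complex.zero_re, Complex.zero_im] at e₁ e₂
  rw [imWronskian]
  linear_combination (cos θ * (dy x).im - sin θ * (y x).im) * e₁
    + (sin θ * (y x).re - cos θ * (dy x).re) * e₂
    - ((y x).re * (dy x).im - (dy x).re * (y x).im) * sin_sq_add_cos_sq θ

/-- For an eigenfunction `y` of a non-real eigenvalue, `Im (conj y * y')` is monotone in the same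
direction on both intervals, while it vanishes at `±π` and the transmission conditions preserve its
sign. Hence it vanishes identically, and so does its derivative, a multiple of `|y|²`. -/
theorem IsEigenvalue.im_eq_zero {P : TwoIntervalSL} (hp₁ : 0 < P.p₁) (hp₂ : 0 < P.p₂)
    (h₁₂ : 0 < P.Δ₁₂) (h₃₄ : 0 < P.Δ₃₄) {z : ℂ} (h : P.IsEigenvalue z) : z.im = 0 := by
  obtain ⟨y, dy, ⟨hL, hR⟩, ⟨hα, hβ, a₀, a₁, b₀, b₁, ⟨t₁, t₂, t₃, t₄⟩, hT⟩, x, hx, hx0⟩ := h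
  by_contra hz
  set H : ℝ → ℝ := fun t => -z.im * imWronskian y dy t with hH
  have hmL : MonotoneOn H (Ico (-π) 0) := monotoneOn_imWronskian hp₁ (convex_Ico _ _) hL
  have hmR : MonotoneOn H (Ioc 0 π) := monotoneOn_imWronskian hp₂ (convex_Ioc _ _) hR
  have hH₁ : H (-π) = 0 := by simp [hH, imWronskian_eq_zero_of_boundary hα]
  have hH₂ : H π = 0 := by simp [hH, imWronskian_eq_zero_of_boundary hβ]
  have hlim : ∀ {l : Filter ℝ} {c₀ c₁ : ℂ}, Tendsto y l (𝓝 c₀) → Tendsto dy l (𝓝 c₁) →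
      Tendsto H l (𝓝 (-z.im * (c₀.re * c₁.im - c₁.re * c₀.im))) := by
    intro l c₀ c₁ h₀ h₁
    have re₀ := (Complex.continuous_re.tendsto _).comp h₀
    have im₀ := (Complex.continuous_im.tendsto _).comp h₀
    have re₁ := (Complex.continuous_re.tendsto _).comp h₁
    have im₁ := (Complex.continuous_im.tendsto _).comp h₁
    exact ((re₀.mul im₁).sub (re₁.mul im₀)).const_mul _
  have hlL := hlim t₁ t₂
  have hlR := hlim t₃ t₄
  have hre := (transmission_iff (P := P) h₁₂.ne' (a₀ := a₀.re) (a₁ := a₁.re) (b₀ := b₀.re)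
    (b₁ := b₁.re)).1 fun i => by simpa using congrArg Complex.re (hT i)
  have him := (transmission_iff (P := P) h₁₂.ne' (a₀ := a₀.im) (a₁ := a₁.im) (b₀ := b₀.im)
    (b₁ := b₁.im)).1 fun i => by simpa using congrArg Complex.im (hT i)
  have htr : P.Δ₁₂ * (-z.im * (b₀.re * b₁.im - b₁.re * b₀.im))
      = P.Δ₃₄ * (-z.im * (a₀.re * a₁.im - a₁.re * a₀.im)) := by
    rw [hre.1, hre.2, him.1, him.2]
    have := h₁₂.ne'
    field_simp
    linear_combination -(a₀.re * a₁.im - a₁.re * a₀.im) * P.minor_relation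
  set A := -z.im * (a₀.re * a₁.im - a₁.re * a₀.im)
  set B := -z.im * (b₀.re * b₁.im - b₁.re * b₀.im)
  have hπ := pi_pos
  have hleA : ∀ t ∈ Ico (-π) 0, H t ≤ A := by
    intro t ht
    refine ge_of_tendsto hlL ?_
    filter_upwards [Ico_mem_nhdsLT ht.2] with r hr using hmL ht ⟨ht.1.trans hr.1, hr.2⟩ hr.1
  have hgeB : ∀ t ∈ Ioc 0 π, B ≤ H t := by
    intro t ht
    refine le_of_tendsto hlR ?_
    filter_upwards [Ioc_mem_nhdsGT ht.1] with r hr using hmR ⟨hr.1, hr.2.trans ht.2⟩ ht hr.2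
  have hgeL : ∀ t ∈ Ico (-π) 0, 0 ≤ H t := fun t ht =>
    hH₁ ▸ hmL ⟨le_rfl, by linarith⟩ ht ht.1
  have hleR : ∀ t ∈ Ioc 0 π, H t ≤ 0 := fun t ht => hH₂ ▸ hmR ht ⟨hπ, le_rfl⟩ ht.2
  have hA : 0 ≤ A := (hgeL (-π) ⟨le_rfl, by linarith⟩).trans (hleA (-π) ⟨le_rfl, by linarith⟩)
  have hB : B ≤ 0 := (hgeB π ⟨hπ, le_rfl⟩).trans (hleR π ⟨hπ, le_rfl⟩)
  have hA' : P.Δ₃₄ * A ≤ 0 := htr ▸ mul_nonpos_of_nonneg_of_nonpos h₁₂.le hB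
  have hA0 : A = 0 := le_antisymm (nonpos_of_mul_nonpos_right hA' h₃₄) hA
  have hB0 : B = 0 := by
    rw [hA0, mul_zero] at htr
    exact (mul_eq_zero.1 htr).resolve_left h₁₂.ne'
  refine hx0 ?_
  rcases hx with hx | hx
  · exact hL.eq_zero_of_imWronskian_eq_zero hp₁.ne' hz (uniqueDiffOn_Ico _ _)
      (fun t ht => le_antisymm (hA0 ▸ hleA t ht) (hgeL t ht)) hx
  · exact hR.eq_zero_of_imWronskian_eq_zero hp₂.ne' hz (uniqueDiffOn_Ioc _ _)
      (fun t ht => le_antisymm (hleR t ht) (hB0 ▸ hgeB t ht)) hx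

end TwoIntervalSL

/-! ### The weighted Hilbert space -/

namespace TwoIntervalSL

/-- The measure on `(-π, π]` whose `L²` inner product is `TwoIntervalSL.form`. -/
def weight (P : TwoIntervalSL) : Measure ℝ :=
  ENNReal.ofReal (P.Δ₃₄ / P.p₁) • volume.restrict (Ioc (-π) 0) +
    ENNReal.ofReal (P.Δ₁₂ / P.p₂) • volume.restrict (Ioc 0 π)

instance (P : TwoIntervalSL) : IsFiniteMeasure P.weight := by
  have h₁ := Measure.smul_finite (volume.restrict (Ioc (-π) 0))
    (ENNReal.ofReal_ne_top (r := P.Δ₃₄ / P.p₁))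
  have h₂ := Measure.smul_finite (volume.restrict (Ioc 0 π))
    (ENNReal.ofReal_ne_top (r := P.Δ₁₂ / P.p₂))
  rw [weight]
  infer_instance

instance (P : TwoIntervalSL) : NullSingletonClass P.weight := ⟨fun x => by simp [weight]⟩

theorem weight_ae_iff {P : TwoIntervalSL} (hA : 0 < P.Δ₃₄ / P.p₁) (hB : 0 < P.Δ₁₂ / P.p₂)
    {p : ℝ → Prop} : (∀ᵐ x ∂P.weight, p x) ↔
      (∀ᵐ x ∂volume.restrict (Icc (-π) 0), p x) ∧ ∀ᵐ x ∂volume.restrict (Icc 0 π), p x := by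
  rw [weight, ae_add_measure_iff, Measure.ae_ennreal_smul_measure_iff (by simpa using hA),
    Measure.ae_ennreal_smul_measure_iff (by simpa using hB), restrict_Ioc_eq_restrict_Icc,
    restrict_Ioc_eq_restrict_Icc]

theorem integral_weight {P : TwoIntervalSL} (hA : 0 < P.Δ₃₄ / P.p₁) (hB : 0 < P.Δ₁₂ / P.p₂)
    {g : ℝ → ℝ} (hg : Integrable g P.weight) :
    ∫ x, g x ∂P.weight
      = P.Δ₃₄ / P.p₁ * (∫ x in (-π)..0, g x) + P.Δ₁₂ / P.p₂ * ∫ x in (0)..π, g x := by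
  rw [weight, integrable_add_measure] at hg
  rw [weight, integral_add_measure hg.1 hg.2, integral_smul_measure, integral_smul_measure,
    ENNReal.toReal_ofReal hA.le, ENNReal.toReal_ofReal hB.le, smul_eq_mul, smul_eq_mul,
    intervalIntegral.integral_of_le (by linarith [pi_pos]),
    intervalIntegral.integral_of_le pi_pos.le]

theorem intervalIntegrable_of_weight {P : TwoIntervalSL} (hA : 0 < P.Δ₃₄ / P.p₁)
    (hB : 0 < P.Δ₁₂ / P.p₂) {g : ℝ → ℝ} (hg : Integrable g P.weight) :
    IntervalIntegrable g volume (-π) 0 ∧ IntervalIntegrable g volume 0 π := by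
  rw [weight, integrable_add_measure, integrable_smul_measure (by simpa using hA)
    ENNReal.ofReal_ne_top, integrable_smul_measure (by simpa using hB)
    ENNReal.ofReal_ne_top] at hg
  exact ⟨(intervalIntegrable_iff_integrableOn_Ioc_of_le (by linarith [pi_pos])).2 hg.1,
    (intervalIntegrable_iff_integrableOn_Ioc_of_le pi_pos.le).2 hg.2⟩

theorem memLp_weight (P : TwoIntervalSL) {f : ℝ → ℝ}
    (hf : MemLp f 2 (volume.restrict (Ico (-π) 0 ∪ Ioc 0 π))) : MemLp f 2 P.weight := by
  have hL : MemLp f 2 (volume.restrict (Ioc (-π) 0)) := by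
    rw [restrict_Ioc_eq_restrict_Icc, ← restrict_Ico_eq_restrict_Icc]
    exact hf.mono_measure (Measure.restrict_mono subset_union_left le_rfl)
  have hR : MemLp f 2 (volume.restrict (Ioc 0 π)) :=
    hf.mono_measure (Measure.restrict_mono subset_union_right le_rfl)
  have hL' := hL.smul_measure (ENNReal.ofReal_ne_top (r := P.Δ₃₄ / P.p₁))
  have hR' := hR.smul_measure (ENNReal.ofReal_ne_top (r := P.Δ₁₂ / P.p₂))
  rw [weight, memLp_two_iff_integrable_sq (hL'.1.add_measure hR'.1)]
  exact hL'.integrable_sq.add_measure hR'.integrable_sq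

theorem form_eq_integral {P : TwoIntervalSL} (hA : 0 < P.Δ₃₄ / P.p₁) (hB : 0 < P.Δ₁₂ / P.p₂)
    {f g : ℝ → ℝ} (hf : MemLp f 2 P.weight) (hg : MemLp g 2 P.weight) :
    P.form f g = ∫ x, f x * g x ∂P.weight :=
  (integral_weight hA hB (hf.integrable_mul hg)).symm

/-- The indicators of the intervals `(1 / (n + 2), 1 / (n + 1)]` are linearly independent. -/
theorem infinite_dimensional_weight {P : TwoIntervalSL} (hB : 0 < P.Δ₁₂ / P.p₂) :
    ¬ FiniteDimensional ℝ (Lp ℝ 2 P.weight) := by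
  intro hfin
  set r : ℕ → ℝ := fun n => 1 / ((n : ℝ) + 1) with hr
  have hr_lt : ∀ n, r (n + 1) < r n := fun n => by
    simp only [hr]
    push_cast
    gcongr
    linarith
  have hdisj := (antitone_nat_of_succ_le fun n => (hr_lt n).le).pairwise_disjoint_on_Ioc_succ
  let e : ℕ → Lp ℝ 2 P.weight := fun n =>
    indicatorConstLp 2 (measurableSet_Ioc (a := r (n + 1)) (b := r n)) (by finiteness) (1 : ℝ)
  have hinner : ∀ i j, inner ℝ (e i) (e j)
      = P.weight.real (Ioc (r (i + 1)) (r i) ∩ Ioc (r (j + 1)) (r j)) := fun i j =>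
    L2.real_inner_indicatorConstLp_one_indicatorConstLp_one _ _
  have hpos : ∀ n, e n ≠ 0 := by
    intro n h
    have h₁ := hinner n n
    rw [h, inner_zero_left, inter_self, eq_comm, measureReal_eq_zero_iff, weight, Measure.add_apply,
      add_eq_zero] at h₁
    have h₂ := h₁.2
    have hsub : Ioc (r (n + 1)) (r n) ⊆ Ioc 0 π := by
      refine Ioc_subset_Ioc (by positivity) ?_
      have : r n ≤ 1 := by
        simp only [hr]
        rw [div_le_one (by positivity)]
        linarith [(Nat.cast_nonneg n : (0 : ℝ) ≤ n)]
      linarith [pi_gt_three]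
    rw [Measure.smul_apply, smul_eq_mul, Measure.restrict_eq_self _ hsub, Real.volume_Ioc,
      mul_eq_zero] at h₂
    rcases h₂ with h₂ | h₂
    · exact absurd (ENNReal.ofReal_eq_zero.1 h₂) (not_le.2 hB)
    · linarith [ENNReal.ofReal_eq_zero.1 h₂, hr_lt n]
  have hli : LinearIndependent ℝ e := by
    refine linearIndependent_of_ne_zero_of_inner_eq_zero hpos fun i j hij => ?_
    have hd : Disjoint (Ioc (r (i + 1)) (r i)) (Ioc (r (j + 1)) (r j)) := hdisj hij
    change inner ℝ (e i) (e j) = 0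
    rw [hinner, hd.inter_eq, measureReal_empty]
  exact not_finite_iff_infinite.2 inferInstance hli.finite

variable {P : TwoIntervalSL} {Q : P.PotentialExtension} {lam lam' : ℝ}

namespace Sol

theorem measurable_fn (s : Sol P Q lam) : Measurable s.fn :=
  Measurable.ite measurableSet_Iic s.left.cont_u.measurable s.right.cont_u.measurable

theorem exists_bound_fn (s : Sol P Q lam) : ∃ C, ∀ x ∈ Icc (-π) π, ‖s.fn x‖ ≤ C := by
  obtain ⟨C₁, h₁⟩ := (isCompact_Icc (a := -π) (b := π)).exists_bound_of_continuousOn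
    s.left.cont_u.continuousOn
  obtain ⟨C₂, h₂⟩ := (isCompact_Icc (a := -π) (b := π)).exists_bound_of_continuousOn
    s.right.cont_u.continuousOn
  refine ⟨max C₁ C₂, fun x hx => ?_⟩
  rw [fn]
  split_ifs
  · exact (h₁ x hx).trans (le_max_left _ _)
  · exact (h₂ x hx).trans (le_max_right _ _)

end Sol

theorem weight_ae_mem_Icc (P : TwoIntervalSL) : ∀ᵐ x ∂P.weight, x ∈ Icc (-π) π := by
  rw [weight, ae_add_measure_iff]
  constructor
  · refine Measure.ae_smul_measure ?_ _
    filter_upwards [ae_restrict_mem measurableSet_Ioc] with x hx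
    exact ⟨hx.1.le, hx.2.trans pi_pos.le⟩
  · refine Measure.ae_smul_measure ?_ _
    filter_upwards [ae_restrict_mem measurableSet_Ioc] with x hx
    exact ⟨by linarith [hx.1, pi_pos], hx.2⟩

namespace Sol

theorem memLp_fn (s : Sol P Q lam) : MemLp s.fn 2 P.weight := by
  obtain ⟨C, hC⟩ := s.exists_bound_fn
  exact MemLp.of_bound s.measurable_fn.aestronglyMeasurable C
    (P.weight_ae_mem_Icc.mono fun x hx => hC x hx)

/-- The solution as a vector of the weighted `L²` space. -/
def vec (s : Sol P Q lam) : Lp ℝ 2 P.weight := s.memLp_fn.toLp s.fn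

theorem ae_eq_fn (hA : 0 < P.Δ₃₄ / P.p₁) (hB : 0 < P.Δ₁₂ / P.p₂) (s : Sol P Q lam) {u : ℝ → ℝ}
    (hL : u =ᵐ[volume.restrict (Icc (-π) 0)] s.uL) (hR : u =ᵐ[volume.restrict (Icc 0 π)] s.uR) :
    u =ᵐ[P.weight] s.fn := by
  refine (weight_ae_iff hA hB).2 ⟨?_, ?_⟩
  · filter_upwards [hL, ae_restrict_mem measurableSet_Icc] with x hx hxm
    rw [hx, s.fn_eqOn_left hxm.2]
  · rw [EventuallyEq, ← restrict_Ioc_eq_restrict_Icc] at *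
    filter_upwards [hR, ae_restrict_mem measurableSet_Ioc] with x hx hxm
    rw [hx, s.fn_eqOn_right hxm.1]

theorem inner_vec (hA : 0 < P.Δ₃₄ / P.p₁) (hB : 0 < P.Δ₁₂ / P.p₂) (s : Sol P Q lam)
    (t : Sol P Q lam') : inner ℝ s.vec t.vec
      = P.Δ₃₄ / P.p₁ * (∫ x in (-π)..0, s.uL x * t.uL x)
        + P.Δ₁₂ / P.p₂ * ∫ x in (0)..π, s.uR x * t.uR x := by
  have hint : Integrable (fun x => s.fn x * t.fn x) P.weight := s.memLp_fn.integrable_mul t.memLp_fn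
  rw [vec, vec, inner_toLp, integral_weight hA hB hint]
  congr 2
  · refine intervalIntegral.integral_congr fun x hx => ?_
    rw [uIcc_of_le (by linarith [pi_pos])] at hx
    simp only [s.fn_eqOn_left hx.2, t.fn_eqOn_left hx.2]
  · refine intervalIntegral.integral_congr_ae' (ae_of_all _ fun x hx => ?_)
      (ae_of_all _ fun x hx => ?_)
    · rw [s.fn_eqOn_right hx.1, t.fn_eqOn_right hx.1]
    · exact absurd (hx.1.trans_le hx.2) (not_lt.2 pi_pos.le)

/-- The Wronskian at `-π` of two solutions that satisfy the left boundary condition vanishes. -/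
theorem BCLeft.wronskian {s : Sol P Q lam} {t : Sol P Q lam'} (hs : s.BCLeft) (ht : t.BCLeft) :
    s.uL (-π) * t.vL (-π) - s.vL (-π) * t.uL (-π) = 0 := by
  rw [BCLeft] at hs ht
  linear_combination (cos P.α * t.vL (-π) - sin P.α * t.uL (-π)) * hs
    + (sin P.α * s.uL (-π) - cos P.α * s.vL (-π)) * ht
    - (s.uL (-π) * t.vL (-π) - s.vL (-π) * t.uL (-π)) * sin_sq_add_cos_sq P.α

/-- The Wronskian at `π` of two solutions that satisfy the right boundary condition vanishes. -/
theorem BCRight.wronskian {s : Sol P Q lam} {t : Sol P Q lam'} (hs : s.BCRight) (ht : t.BCRight) :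
    s.uR π * t.vR π - s.vR π * t.uR π = 0 := by
  rw [BCRight] at hs ht
  linear_combination (cos P.β * t.vR π - sin P.β * t.uR π) * hs
    + (sin P.β * s.uR π - cos P.β * s.vR π) * ht
    - (s.uR π * t.vR π - s.vR π * t.uR π) * sin_sq_add_cos_sq P.β

/-- Eigenfunctions for distinct eigenvalues are orthogonal. -/
theorem inner_vec_eq_zero (hp₁ : 0 < P.p₁) (hp₂ : 0 < P.p₂) (h₁₂ : 0 < P.Δ₁₂) (h₃₄ : 0 < P.Δ₃₄)
    {s : Sol P Q lam} {t : Sol P Q lam'} (hne : lam ≠ lam') (hsl : s.BCLeft) (htl : t.BCLeft)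
    (hsr : s.BCRight) (htr : t.BCRight) : inner ℝ s.vec t.vec = 0 := by
  have hL := s.left.integral_wronskian (c := (lam - lam') / P.p₁) (by linarith [pi_pos]) t.left
    (fun x => by ring)
  have hR := s.right.integral_wronskian (c := (lam - lam') / P.p₂) pi_pos.le t.right
    (fun x => by ring)
  have h0 := wronskian_zero h₁₂.ne' s t
  rw [hsl.wronskian htl] at hL
  rw [hsr.wronskian htr] at hR
  rw [inner_vec (div_pos h₃₄ hp₁) (div_pos h₁₂ hp₂)]
  refine (mul_eq_zero.1 (?_ : (lam - lam') * _ = 0)).resolve_left (sub_ne_zero.2 hne)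
  linear_combination P.Δ₃₄ * hL + P.Δ₁₂ * hR - h0

theorem InitLeft.vec_ne_zero (hA : 0 < P.Δ₃₄ / P.p₁) (hB : 0 < P.Δ₁₂ / P.p₂) {s : Sol P Q lam}
    (hs : s.InitLeft) : s.vec ≠ 0 := by
  intro h
  obtain ⟨x, hx, hx0⟩ := hs.exists_ne_zero
  have h₁ : s.fn =ᵐ[P.weight] 0 := (MemLp.toLp_eq_toLp_iff s.memLp_fn MemLp.zero).1 h
  have h₂ := ((weight_ae_iff hA hB).1 h₁).1
  have h₃ : s.uL =ᵐ[volume.restrict (Icc (-π) 0)] 0 := by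
    filter_upwards [h₂, ae_restrict_mem measurableSet_Icc] with y hy hym
    rw [← s.fn_eqOn_left hym.2, hy]
  exact hx0 (Measure.eqOn_Icc_of_ae_eq volume (by linarith [pi_pos] : -π < 0).ne h₃
    s.left.cont_u.continuousOn continuousOn_const (Ico_subset_Icc_self hx))

end Sol

end TwoIntervalSL

/-! ### Inverting the problem at a point that is not an eigenvalue -/

namespace TwoIntervalSL

variable {P : TwoIntervalSL} {Q : P.PotentialExtension} {lam : ℝ}

namespace Sol

variable {f : ℝ → ℝ}

theorem integrable_fn_mul (s : Sol P Q lam) (hf : MemLp f 2 P.weight) :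
    Integrable (fun x => s.fn x * f x) P.weight := s.memLp_fn.integrable_mul hf

theorem integral_left_fn_mul (s : Sol P Q lam) {x : ℝ} (hx : x ∈ Icc (-π) 0) :
    ∫ τ in (-π)..x, s.fn τ * f τ = ∫ τ in (-π)..x, s.uL τ * f τ := by
  refine intervalIntegral.integral_congr fun τ hτ => ?_
  rw [uIcc_of_le hx.1] at hτ
  simp only [s.fn_eqOn_left (hτ.2.trans hx.2)]

theorem integral_right_fn_mul (s : Sol P Q lam) {x : ℝ} (hx : x ∈ Icc 0 π) :
    ∫ τ in (0)..x, s.fn τ * f τ = ∫ τ in (0)..x, s.uR τ * f τ := by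
  refine intervalIntegral.integral_congr_ae' (ae_of_all _ fun τ hτ => ?_)
    (ae_of_all _ fun τ hτ => ?_)
  · rw [s.fn_eqOn_right hτ.1]
  · exact absurd (hτ.1.trans_le hτ.2) (not_lt.2 hx.1)

theorem setIntegral_Iic_left (hA : 0 < P.Δ₃₄ / P.p₁) (hB : 0 < P.Δ₁₂ / P.p₂) (s : Sol P Q lam)
    (hf : MemLp f 2 P.weight) {x : ℝ} (hx : x ∈ Icc (-π) 0) :
    ∫ τ in Iic x, s.fn τ * f τ ∂P.weight
      = P.Δ₃₄ / P.p₁ * ∫ τ in (-π)..x, s.uL τ * f τ := by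
  have h₁ : ∫ τ in (0)..π, (Iic x).indicator (fun τ => s.fn τ * f τ) τ = 0 := by
    refine (intervalIntegral.integral_congr_ae' (g := fun _ => (0 : ℝ)) (ae_of_all _ fun τ hτ => ?_)
      (ae_of_all _ fun τ hτ => ?_)).trans intervalIntegral.integral_zero
    · exact indicator_of_notMem (fun h => absurd (hτ.1.trans_le (mem_Iic.1 h)) (not_lt.2 hx.2)) _
    · exact absurd (hτ.1.trans_le hτ.2) (not_lt.2 pi_pos.le)
  have h₂ := intervalIntegral.integral_indicator (f := fun τ => s.fn τ * f τ) (μ := volume) hx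
  rw [← integral_indicator measurableSet_Iic, integral_weight hA hB
    ((s.integrable_fn_mul hf).indicator measurableSet_Iic), h₁, mul_zero, add_zero,
    ← s.integral_left_fn_mul hx, ← h₂]
  rfl

theorem setIntegral_Iic_right (hA : 0 < P.Δ₃₄ / P.p₁) (hB : 0 < P.Δ₁₂ / P.p₂) (s : Sol P Q lam)
    (hf : MemLp f 2 P.weight) {x : ℝ} (hx : x ∈ Icc 0 π) :
    ∫ τ in Iic x, s.fn τ * f τ ∂P.weight
      = P.Δ₃₄ / P.p₁ * (∫ τ in (-π)..0, s.uL τ * f τ)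
        + P.Δ₁₂ / P.p₂ * ∫ τ in (0)..x, s.uR τ * f τ := by
  have h₁ : ∫ τ in (-π)..0, (Iic x).indicator (fun τ => s.fn τ * f τ) τ
      = ∫ τ in (-π)..0, s.fn τ * f τ := by
    refine intervalIntegral.integral_congr fun τ hτ => ?_
    rw [uIcc_of_le (by linarith [pi_pos])] at hτ
    have hτx : τ ∈ Iic x := hτ.2.trans hx.1
    simp only [indicator_of_mem hτx]
  have h₂ := intervalIntegral.integral_indicator (f := fun τ => s.fn τ * f τ) (μ := volume) hx
  rw [← integral_indicator measurableSet_Iic, integral_weight hA hB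
    ((s.integrable_fn_mul hf).indicator measurableSet_Iic), h₁,
    ← s.integral_left_fn_mul zero_mem_left, ← s.integral_right_fn_mul hx, ← h₂]
  rfl

theorem setIntegral_Ioi (s : Sol P Q lam) (hf : MemLp f 2 P.weight) (x : ℝ) :
    ∫ τ in Ioi x, s.fn τ * f τ ∂P.weight
      = ∫ τ, s.fn τ * f τ ∂P.weight - ∫ τ in Iic x, s.fn τ * f τ ∂P.weight := by
  rw [← integral_add_compl (measurableSet_Iic (a := x)) (s.integrable_fn_mul hf), compl_Iic]
  ring

theorem integral_fn_mul (hA : 0 < P.Δ₃₄ / P.p₁) (hB : 0 < P.Δ₁₂ / P.p₂) (s : Sol P Q lam)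
    (hf : MemLp f 2 P.weight) : ∫ τ, s.fn τ * f τ ∂P.weight
      = P.Δ₃₄ / P.p₁ * (∫ τ in (-π)..0, s.uL τ * f τ)
        + P.Δ₁₂ / P.p₂ * ∫ τ in (0)..π, s.uR τ * f τ := by
  rw [integral_weight hA hB (s.integrable_fn_mul hf), s.integral_left_fn_mul zero_mem_left,
    s.integral_right_fn_mul pi_mem_right]

/-- The Green operator, up to a constant factor, written on the two intervals. -/
theorem green_ae_iff (hA : 0 < P.Δ₃₄ / P.p₁) (hB : 0 < P.Δ₁₂ / P.p₂) (s t : Sol P Q lam)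
    (hf : MemLp f 2 P.weight) (κ : ℝ) :
    (∀ᵐ x ∂P.weight, κ * f x = t.fn x * (∫ τ in Iic x, s.fn τ * f τ ∂P.weight)
        + s.fn x * ∫ τ in Ioi x, t.fn τ * f τ ∂P.weight) ↔
    (∀ᵐ x ∂volume.restrict (Icc (-π) 0), κ * f x =
        t.uL x * (0 + P.Δ₃₄ / P.p₁ * ∫ τ in (-π)..x, s.uL τ * f τ)
        + s.uL x * ((∫ τ, t.fn τ * f τ ∂P.weight)
          + -(P.Δ₃₄ / P.p₁) * ∫ τ in (-π)..x, t.uL τ * f τ)) ∧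
    ∀ᵐ x ∂volume.restrict (Icc 0 π), κ * f x =
        t.uR x * (P.Δ₃₄ / P.p₁ * (∫ τ in (-π)..0, s.uL τ * f τ)
          + P.Δ₁₂ / P.p₂ * ∫ τ in (0)..x, s.uR τ * f τ)
        + s.uR x * (P.Δ₁₂ / P.p₂ * (∫ τ in (0)..π, t.uR τ * f τ)
          + -(P.Δ₁₂ / P.p₂) * ∫ τ in (0)..x, t.uR τ * f τ) := by
  rw [weight_ae_iff hA hB]
  refine and_congr (eventually_congr ?_) ?_
  · filter_upwards [ae_restrict_mem measurableSet_Icc] with x hx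
    rw [t.setIntegral_Ioi hf, s.setIntegral_Iic_left hA hB hf hx,
      t.setIntegral_Iic_left hA hB hf hx, s.fn_eqOn_left hx.2, t.fn_eqOn_left hx.2, zero_add,
      neg_mul, sub_eq_add_neg]
  · rw [← restrict_Ioc_eq_restrict_Icc]
    refine eventually_congr ?_
    filter_upwards [ae_restrict_mem measurableSet_Ioc] with x hx
    have hx' := Ioc_subset_Icc_self hx
    rw [t.setIntegral_Ioi hf, s.setIntegral_Iic_right hA hB hf hx',
      t.setIntegral_Iic_right hA hB hf hx', s.fn_eqOn_right hx.1, t.fn_eqOn_right hx.1,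
      t.integral_fn_mul hA hB hf, neg_mul, ← sub_eq_add_neg, add_sub_add_left_eq_sub]

variable {ω : ℝ} {s t : Sol P Q lam}

theorem wronskian_right (h : s.uR π * t.vR π - s.vR π * t.uR π = ω) {x : ℝ} (hx : x ∈ Icc 0 π) :
    s.uR x * t.vR x - s.vR x * t.uR x = ω :=
  (s.right.wronskian_const t.right hx pi_mem_right).trans h

theorem wronskian_left (h₁₂ : P.Δ₁₂ ≠ 0) (h₃₄ : P.Δ₃₄ ≠ 0)
    (h : s.uR π * t.vR π - s.vR π * t.uR π = ω) {x : ℝ} (hx : x ∈ Icc (-π) 0) :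
    s.uL x * t.vL x - s.vL x * t.uL x = P.Δ₁₂ * ω / P.Δ₃₄ := by
  rw [s.left.wronskian_const t.left hx zero_mem_left, eq_div_iff h₃₄,
    ← wronskian_right h zero_mem_right, wronskian_zero h₁₂]
  ring

/-- The Green operator is injective. Here `ω` is the Wronskian of `s` and `t` on the right. -/
theorem ae_eq_zero_of_green_eq_zero (hp₁ : 0 < P.p₁) (hp₂ : 0 < P.p₂) (h₁₂ : 0 < P.Δ₁₂)
    (h₃₄ : 0 < P.Δ₃₄) (hω : ω ≠ 0) (h : s.uR π * t.vR π - s.vR π * t.uR π = ω)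
    (hf : MemLp f 2 P.weight)
    (hG : ∀ᵐ x ∂P.weight, 0 = t.fn x * (∫ τ in Iic x, s.fn τ * f τ ∂P.weight)
        + s.fn x * ∫ τ in Ioi x, t.fn τ * f τ ∂P.weight) : f =ᵐ[P.weight] 0 := by
  have hA := div_pos h₃₄ hp₁
  have hB := div_pos h₁₂ hp₂
  obtain ⟨hL, hR⟩ := (green_ae_iff hA hB s t hf 0).1 (by simpa only [zero_mul] using hG)
  obtain ⟨iL, iR⟩ := intervalIntegrable_of_weight hA hB (hf.integrable (by norm_num))
  refine (weight_ae_iff hA hB).2 ⟨?_, ?_⟩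
  · exact ae_eq_zero_of_variation_eq_zero (by linarith [pi_pos]) s.left t.left
      (fun x hx => wronskian_left h₁₂.ne' h₃₄.ne' h hx)
      (div_ne_zero (mul_ne_zero h₁₂.ne' hω) h₃₄.ne') hA.ne' iL
      (hL.mono fun x hx => hx.symm.trans (zero_mul _))
  · exact ae_eq_zero_of_variation_eq_zero pi_pos s.right t.right
      (fun x hx => wronskian_right h hx) hω hB.ne' iR
      (hR.mono fun x hx => hx.symm.trans (zero_mul _))

/-- An eigenvector of the Green operator is a classical eigenfunction of the problem. -/
theorem exists_of_green_eigenvector (hp₁ : 0 < P.p₁) (hp₂ : 0 < P.p₂) (h₁₂ : 0 < P.Δ₁₂)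
    (h₃₄ : 0 < P.Δ₃₄) (hs : s.BCLeft) (ht : t.BCRight)
    (h : s.uR π * t.vR π - s.vR π * t.uR π = ω) (hf : MemLp f 2 P.weight) {κ : ℝ} (hκ : κ ≠ 0)
    (hG : ∀ᵐ x ∂P.weight, κ * f x = t.fn x * (∫ τ in Iic x, s.fn τ * f τ ∂P.weight)
        + s.fn x * ∫ τ in Ioi x, t.fn τ * f τ ∂P.weight) :
    ∃ (lam' : ℝ) (y : Sol P Q lam'), y.BCLeft ∧ y.BCRight ∧ f =ᵐ[P.weight] y.fn := by
  have hA := div_pos h₃₄ hp₁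
  have hB := div_pos h₁₂ hp₂
  obtain ⟨hL, hR⟩ := (green_ae_iff hA hB s t hf κ).1 hG
  obtain ⟨iL, iR⟩ := intervalIntegrable_of_weight hA hB (hf.integrable (by norm_num))
  obtain ⟨yL, zL, hyL, eL, vL⟩ := exists_isSolPair_of_variation (by linarith [pi_pos]) s.left t.left
    (fun x hx => wronskian_left h₁₂.ne' h₃₄.ne' h hx) iL hκ hL
  obtain ⟨yR, zR, hyR, eR, vR⟩ := exists_isSolPair_of_variation pi_pos s.right t.right
    (fun x hx => wronskian_right h hx) iR hκ hR
  obtain ⟨a₀, a₁⟩ := vL (-π) neg_pi_mem_left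
  obtain ⟨b₀, b₁⟩ := vL 0 zero_mem_left
  obtain ⟨c₀, c₁⟩ := vR 0 zero_mem_right
  obtain ⟨d₀, d₁⟩ := vR π pi_mem_right
  rw [t.integral_fn_mul hA hB hf] at b₀ b₁
  simp only [intervalIntegral.integral_same, mul_zero, add_zero] at a₀ a₁ c₀ c₁
  have hL' : (fun x => (Q.qL x - lam) / P.p₁ + P.Δ₃₄ / P.p₁ * (P.Δ₁₂ * ω / P.Δ₃₄) / κ)
      = fun x => (Q.qL x - (lam - P.Δ₁₂ * ω / κ)) / P.p₁ := by
    ext x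
    field_simp
    ring
  have hR' : (fun x => (Q.qR x - lam) / P.p₂ + P.Δ₁₂ / P.p₂ * ω / κ)
      = fun x => (Q.qR x - (lam - P.Δ₁₂ * ω / κ)) / P.p₂ := by
    ext x
    field_simp
    ring
  rw [hL'] at hyL
  rw [hR'] at hyR
  have hs₀ := s.trans₀
  have hs₁ := s.trans₁
  have ht₀ := t.trans₀
  have ht₁ := t.trans₁
  refine ⟨lam - P.Δ₁₂ * ω / κ, ⟨yL, zL, yR, zR, hyL, hyR, ?_, ?_⟩, ?_, ?_, ae_eq_fn hA hB _ eL eR⟩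
  · refine mul_left_cancel₀ hκ ?_
    rw [c₀, hs₀, ht₀]
    linear_combination -(1 / P.Δ₁₂ * P.Δ₂₃) * b₀ - (1 / P.Δ₁₂ * P.Δ₂₄) * b₁
  · refine mul_left_cancel₀ hκ ?_
    rw [c₁, hs₁, ht₁]
    linear_combination -(-1 / P.Δ₁₂ * P.Δ₁₃) * b₀ - (-1 / P.Δ₁₂ * P.Δ₁₄) * b₁
  · refine (mul_eq_zero.1 (?_ : κ * _ = 0)).resolve_left hκ
    rw [BCLeft] at hs
    linear_combination cos P.α * a₀ + sin P.α * a₁ + (∫ τ, t.fn τ * f τ ∂P.weight) * hs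
  · refine (mul_eq_zero.1 (?_ : κ * _ = 0)).resolve_left hκ
    rw [BCRight] at ht
    linear_combination cos P.β * d₀ + sin P.β * d₁
      + (P.Δ₃₄ / P.p₁ * (∫ τ in (-π)..0, s.uL τ * f τ)
          + P.Δ₁₂ / P.p₂ * ∫ τ in (0)..π, s.uR τ * f τ) * ht

end Sol

/-- Every vector orthogonal to all eigenfunctions vanishes, provided that some real number is not
an eigenvalue. -/
theorem eq_zero_of_orthogonal_eigenfunctions (hp₁ : 0 < P.p₁) (hp₂ : 0 < P.p₂) (h₁₂ : 0 < P.Δ₁₂)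
    (h₃₄ : 0 < P.Δ₃₄) (Q : P.PotentialExtension) {lam₀ : ℝ} (h₀ : ¬ P.IsEigenvalue lam₀)
    {g : Lp ℝ 2 P.weight}
    (hg : ∀ (lam : ℝ) (y : Sol P Q lam), y.BCLeft → y.BCRight → inner ℝ y.vec g = 0) : g = 0 := by
  obtain ⟨s, hs⟩ := Sol.exists_initLeft P Q lam₀
  obtain ⟨t, ht₀, ht₁⟩ := Sol.exists_initRight Q lam₀ h₁₂.ne' h₃₄.ne'
  have htr : t.BCRight := by rw [Sol.BCRight, ht₀, ht₁]; ring
  -- the Wronskian is, up to sign, the right boundary condition of `s`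
  set ω : ℝ := s.uR π * t.vR π - s.vR π * t.uR π with hω
  have hω0 : ω ≠ 0 := by
    intro h
    refine h₀ ?_
    obtain ⟨x, hx, hx0⟩ := hs.exists_ne_zero
    refine s.isEigenvalue hp₁.ne' hp₂.ne' h₁₂.ne' hs.bcLeft ?_
      ⟨x, Or.inl hx, by rwa [s.fn_eqOn_Ico hx]⟩
    rw [hω, ht₀, ht₁] at h
    rw [Sol.BCRight]
    linear_combination -h
  obtain ⟨C₁, hC₁⟩ := s.exists_bound_fn
  obtain ⟨C₂, hC₂⟩ := t.exists_bound_fn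
  obtain ⟨G, hGc, hGs, hG⟩ := exists_green_operator (μ := P.weight) (φ := s.fn) (χ := t.fn)
    (a := -π) (b := π) (C := max C₁ C₂) (by linarith [pi_pos]) P.weight_ae_mem_Icc
    s.measurable_fn.aestronglyMeasurable t.measurable_fn.aestronglyMeasurable
    (P.weight_ae_mem_Icc.mono fun x hx => (hC₁ x hx).trans (le_max_left _ _))
    (P.weight_ae_mem_Icc.mono fun x hx => (hC₂ x hx).trans (le_max_right _ _))
  -- zero is not an eigenvalue of `G`, and the other eigenvectors are eigenfunctions of the problem
  have hbot := ContinuousLinearMap.orthogonalComplement_iSup_eigenspaces_eq_bot hGc hGs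
  have hmem : g ∈ (⨆ κ, Module.End.eigenspace (G : Module.End ℝ (Lp ℝ 2 P.weight)) κ)ᗮ := by
    rw [← Submodule.iInf_orthogonal, Submodule.mem_iInf]
    intro κ
    rw [Submodule.mem_orthogonal]
    intro f hf
    have hGf : G f = κ • f := Module.End.mem_eigenspace_iff.1 hf
    have hae : ∀ᵐ x ∂P.weight, κ * f x = t.fn x * (∫ τ in Iic x, s.fn τ * f τ ∂P.weight)
        + s.fn x * ∫ τ in Ioi x, t.fn τ * f τ ∂P.weight := by
      have h₁ := hG f
      rw [hGf] at h₁
      filter_upwards [h₁, Lp.coeFn_smul κ f] with x hx hx'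
      rw [← hx, hx', Pi.smul_apply, smul_eq_mul]
    by_cases hκ : κ = 0
    · have hf0 : f = 0 := (Lp.eq_zero_iff_ae_eq_zero).2
        (Sol.ae_eq_zero_of_green_eq_zero hp₁ hp₂ h₁₂ h₃₄ hω0 rfl (Lp.memLp f)
          (by simpa only [hκ, zero_mul] using hae))
      rw [hf0, inner_zero_left]
    · obtain ⟨lam, y, hyl, hyr, hfy⟩ := Sol.exists_of_green_eigenvector hp₁ hp₂ h₁₂ h₃₄ hs.bcLeft htr
        rfl (Lp.memLp f) hκ hae
      have hfv : f = y.vec := Lp.ext (hfy.trans y.memLp_fn.coeFn_toLp.symm)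
      rw [hfv]
      exact hg lam y hyl hyr
  rw [hbot] at hmem
  exact (Submodule.mem_bot ℝ).1 hmem

end TwoIntervalSL

/-! ### Completeness of the eigenfunctions -/

/-- In a separable space the balls of radius `1 / 2` around the members of an orthonormal family are
disjoint open sets, so the family is countable. -/
theorem Orthonormal.countable {ι H : Type*} [NormedAddCommGroup H] [InnerProductSpace ℝ H]
    [SecondCountableTopology H] {v : ι → H} (hv : Orthonormal ℝ v) : Countable ι := by
  rw [← countable_univ_iff]
  refine Set.PairwiseDisjoint.countable_of_isOpen (s := fun i => Metric.ball (v i) (1 / 2))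
    (fun i _ j _ hij => Metric.ball_disjoint_ball ?_) (fun i _ => Metric.isOpen_ball)
    (fun i _ => ⟨v i, Metric.mem_ball_self (by norm_num)⟩)
  rw [dist_eq_norm]
  have h : ‖v i - v j‖ ^ 2 = 2 := by
    rw [norm_sub_sq_real, hv.1 i, hv.1 j, hv.2 hij]
    norm_num
  nlinarith [norm_nonneg (v i - v j)]

namespace TwoIntervalSL

variable {P : TwoIntervalSL} {Q : P.PotentialExtension} {lam : ℝ}

namespace Sol

theorem BCLeft.exists_vec_eq_smul (hA : 0 < P.Δ₃₄ / P.p₁) (hB : 0 < P.Δ₁₂ / P.p₂)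
    {y t : Sol P Q lam} (hy : y.BCLeft) (ht : t.InitLeft) :
    ∃ c : ℝ, y.vec = c • t.vec ∧ (y.BCRight → c ≠ 0 → t.BCRight) := by
  obtain ⟨c, hl, hr⟩ := hy.exists_eq_const_mul ht
  refine ⟨c, ?_, fun hyr hc => ?_⟩
  · have hae : (fun x => c * t.fn x) =ᵐ[P.weight] y.fn := by
      refine y.ae_eq_fn hA hB ?_ ?_
      · filter_upwards [ae_restrict_mem measurableSet_Icc] with x hx
        rw [t.fn_eqOn_left hx.2, (hl x hx).1]
      · rw [← restrict_Ioc_eq_restrict_Icc]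
        filter_upwards [ae_restrict_mem measurableSet_Ioc] with x hx
        rw [t.fn_eqOn_right hx.1, (hr x (Ioc_subset_Icc_self hx)).1]
    refine Lp.ext ?_
    filter_upwards [hae, y.memLp_fn.coeFn_toLp, t.memLp_fn.coeFn_toLp, Lp.coeFn_smul c t.vec]
      with x h₁ h₂ h₃ h₄
    rw [h₄, Pi.smul_apply, smul_eq_mul, vec, vec, h₂, h₃, h₁]
  · rw [BCRight, (hr π pi_mem_right).1, (hr π pi_mem_right).2] at hyr
    refine (mul_eq_zero.1 (?_ : c * _ = 0)).resolve_left hc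
    linear_combination hyr

theorem InitLeft.isEigenvalue_iff (hp₁ : P.p₁ ≠ 0) (hp₂ : P.p₂ ≠ 0) (h₁₂ : P.Δ₁₂ ≠ 0)
    {s : Sol P Q lam} (hs : s.InitLeft) : P.IsEigenvalue lam ↔ s.BCRight := by
  refine ⟨fun h => h.bcRight hp₁ hp₂ h₁₂ hs, fun h => ?_⟩
  obtain ⟨x, hx, hx0⟩ := hs.exists_ne_zero
  exact s.isEigenvalue hp₁ hp₂ h₁₂ hs.bcLeft h ⟨x, Or.inl hx, by rwa [s.fn_eqOn_Ico hx]⟩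

theorem orthonormal_vec (hp₁ : 0 < P.p₁) (hp₂ : 0 < P.p₂) (h₁₂ : 0 < P.Δ₁₂) (h₃₄ : 0 < P.Δ₃₄)
    {ι : Type*} {lam : ι → ℝ} (hinj : Function.Injective lam) (heig : ∀ i, P.IsEigenvalue (lam i))
    (s : ∀ i, Sol P Q (lam i)) (hs : ∀ i, (s i).InitLeft) :
    Orthonormal ℝ fun i => ‖(s i).vec‖⁻¹ • (s i).vec := by
  have hr : ∀ i, (s i).BCRight := fun i =>
    ((hs i).isEigenvalue_iff hp₁.ne' hp₂.ne' h₁₂.ne').1 (heig i)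
  refine ⟨fun i => ?_, fun i j hij => ?_⟩
  · rw [norm_smul, norm_inv, norm_norm, inv_mul_cancel₀]
    exact norm_ne_zero_iff.2 ((hs i).vec_ne_zero (div_pos h₃₄ hp₁) (div_pos h₁₂ hp₂))
  · change inner ℝ (‖(s i).vec‖⁻¹ • (s i).vec) (‖(s j).vec‖⁻¹ • (s j).vec) = 0
    rw [real_inner_smul_left, real_inner_smul_right, inner_vec_eq_zero hp₁ hp₂ h₁₂ h₃₄
      (fun h => hij (hinj h)) (hs i).bcLeft (hs j).bcLeft (hr i) (hr j), mul_zero, mul_zero]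

end Sol

/-- Eigenfunctions are orthogonal and `L²` is separable. -/
theorem countable_eigenvalues (hp₁ : 0 < P.p₁) (hp₂ : 0 < P.p₂) (h₁₂ : 0 < P.Δ₁₂)
    (h₃₄ : 0 < P.Δ₃₄) (Q : P.PotentialExtension) :
    {lam : ℝ | P.IsEigenvalue lam}.Countable := by
  choose s hs using Sol.exists_initLeft P Q
  have : Fact ((2 : ENNReal) ≠ ⊤) := ⟨ENNReal.ofNat_ne_top⟩
  exact (Sol.orthonormal_vec hp₁ hp₂ h₁₂ h₃₄
    (lam := fun i : {lam : ℝ | P.IsEigenvalue lam} => (i : ℝ)) Subtype.val_injective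
    (fun i => i.2) (fun i => s i) (fun i => hs i)).countable.to_set

/-- The normalized eigenfunctions are total. A real number that is not an eigenvalue exists because
there are only countably many eigenvalues. -/
theorem orthogonal_span_vec (hp₁ : 0 < P.p₁) (hp₂ : 0 < P.p₂) (h₁₂ : 0 < P.Δ₁₂) (h₃₄ : 0 < P.Δ₃₄)
    {ι : Type*} {lam : ι → ℝ} (hall : ∀ l : ℝ, P.IsEigenvalue l → ∃ i, l = lam i)
    (s : ∀ i, Sol P Q (lam i)) (hs : ∀ i, (s i).InitLeft) :
    (Submodule.span ℝ (range fun i => ‖(s i).vec‖⁻¹ • (s i).vec))ᗮ = ⊥ := by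
  have hA := div_pos h₃₄ hp₁
  have hB := div_pos h₁₂ hp₂
  obtain ⟨lam₀, h₀⟩ : ∃ lam₀ : ℝ, ¬ P.IsEigenvalue lam₀ := by
    by_contra! h
    refine not_countable (α := ℝ) ?_
    rw [← countable_univ_iff, ← eq_univ_of_forall (s := {lam : ℝ | P.IsEigenvalue lam}) h]
    exact countable_eigenvalues hp₁ hp₂ h₁₂ h₃₄ Q
  refine (Submodule.eq_bot_iff _).2 fun g hg => ?_
  refine eq_zero_of_orthogonal_eigenfunctions hp₁ hp₂ h₁₂ h₃₄ Q h₀ fun l y hyl hyr => ?_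
  obtain ⟨t, ht⟩ := Sol.exists_initLeft P Q l
  obtain ⟨c, hc, htr⟩ := hyl.exists_vec_eq_smul hA hB ht
  by_cases hc0 : c = 0
  · rw [hc, hc0, zero_smul, inner_zero_left]
  obtain ⟨i, rfl⟩ := hall l ((ht.isEigenvalue_iff hp₁.ne' hp₂.ne' h₁₂.ne').2 (htr hyr hc0))
  obtain ⟨c', hc', -⟩ := hyl.exists_vec_eq_smul hA hB (hs i)
  have h₁ := (Submodule.mem_orthogonal _ g).1 hg _ (Submodule.subset_span ⟨i, rfl⟩)
  rw [real_inner_smul_left] at h₁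
  rw [hc', real_inner_smul_left, (mul_eq_zero.1 h₁).resolve_left
    (inv_ne_zero (norm_ne_zero_iff.2 ((hs i).vec_ne_zero hA hB))), mul_zero]

/-- The problem has infinitely many eigenvalues because the weighted `L²` space has infinite
dimension. -/
theorem infinite_eigenvalues (hp₁ : 0 < P.p₁) (hp₂ : 0 < P.p₂) (h₁₂ : 0 < P.Δ₁₂)
    (h₃₄ : 0 < P.Δ₃₄) (Q : P.PotentialExtension) :
    {lam : ℝ | P.IsEigenvalue lam}.Infinite := by
  intro hfin
  choose s hs using Sol.exists_initLeft P Q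
  have := hfin.fintype
  let b := HilbertBasis.mkOfOrthogonalEqBot
    (Sol.orthonormal_vec hp₁ hp₂ h₁₂ h₃₄
      (lam := fun i : {lam : ℝ | P.IsEigenvalue lam} => (i : ℝ)) Subtype.val_injective
      (fun i => i.2) (fun i => s i) (fun i => hs i))
    (orthogonal_span_vec hp₁ hp₂ h₁₂ h₃₄
      (lam := fun i : {lam : ℝ | P.IsEigenvalue lam} => (i : ℝ))
      (fun l hl => ⟨⟨l, hl⟩, rfl⟩) (fun i => s i) fun i => hs i)
  exact infinite_dimensional_weight (div_pos h₁₂ hp₂)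
    b.toOrthonormalBasis.toBasis.finiteDimensional_of_finite

theorem exists_isEigensystem (hp₁ : 0 < P.p₁) (hp₂ : 0 < P.p₂) (h₁₂ : 0 < P.Δ₁₂)
    (h₃₄ : 0 < P.Δ₃₄) (Q : P.PotentialExtension) :
    ∃ (lam : ℕ → ℝ) (φ : ℕ → ℝ → ℝ), P.IsEigensystem lam φ := by
  have := (infinite_eigenvalues hp₁ hp₂ h₁₂ h₃₄ Q).to_subtype
  have := (countable_eigenvalues hp₁ hp₂ h₁₂ h₃₄ Q).to_subtype
  obtain ⟨hden⟩ := nonempty_denumerable {lam : ℝ | P.IsEigenvalue lam}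
  let e := (Denumerable.eqv {lam : ℝ | P.IsEigenvalue lam}).symm
  choose s hs using Sol.exists_initLeft P Q
  refine ⟨fun n => e n, fun n => (s (e n)).fn, Subtype.val_injective.comp e.injective,
    fun z => ⟨fun hz => ?_, ?_⟩, fun n => Sol.isPhi hp₁.ne' hp₂.ne' (hs _)⟩
  · have hre : z = (z.re : ℂ) :=
      Complex.ext rfl (by simpa using hz.im_eq_zero hp₁ hp₂ h₁₂ h₃₄)
    rw [hre] at hz
    refine ⟨e.symm ⟨z.re, hz⟩, ?_⟩
    simpa only [Equiv.apply_symm_apply] using hre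
  · rintro ⟨n, rfl⟩
    exact (e n).2

/-- Parseval's equality for the Hilbert basis of normalized eigenfunctions. -/
theorem IsEigensystem.hasSum_coeff_sq (hp₁ : 0 < P.p₁) (hp₂ : 0 < P.p₂) (h₁₂ : 0 < P.Δ₁₂)
    (h₃₄ : 0 < P.Δ₃₄) (Q : P.PotentialExtension) {lam : ℕ → ℝ} {φ : ℕ → ℝ → ℝ}
    (h : P.IsEigensystem lam φ) {f : ℝ → ℝ} (hf : MemLp f 2 P.weight) :
    HasSum (fun n => P.coeff φ f n ^ 2) (P.form f f) := by
  have hA := div_pos h₃₄ hp₁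
  have hB := div_pos h₁₂ hp₂
  obtain ⟨hinj, heig, hφ⟩ := h
  choose s hs hsL hsR using fun n => (hφ n).exists_sol hp₁.ne' hp₂.ne' Q
  let b := HilbertBasis.mkOfOrthogonalEqBot
    (Sol.orthonormal_vec hp₁ hp₂ h₁₂ h₃₄ hinj (fun n => (heig _).2 ⟨n, rfl⟩) s hs)
    (orthogonal_span_vec hp₁ hp₂ h₁₂ h₃₄
      (fun l hl => ((heig l).1 hl).imp fun n hn => Complex.ofReal_injective hn) s hs)
  have hb : ∀ n, b n = ‖(s n).vec‖⁻¹ • (s n).vec := fun n =>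
    congrFun (HilbertBasis.coe_mkOfOrthogonalEqBot _ _) n
  have hae : ∀ n, φ n =ᵐ[P.weight] (s n).fn := by
    intro n
    refine (s n).ae_eq_fn hA hB ?_ ?_
    · rw [← restrict_Ico_eq_restrict_Icc]
      filter_upwards [ae_restrict_mem measurableSet_Ico] with x hx using hsL n hx
    · rw [← restrict_Ioc_eq_restrict_Icc]
      filter_upwards [ae_restrict_mem measurableSet_Ioc] with x hx using hsR n hx
  have hmem : ∀ n, MemLp (φ n) 2 P.weight := fun n => (s n).memLp_fn.ae_eq (hae n).symm
  have hnorm : ∀ n, P.form (φ n) (φ n) ^ (-(1 / 2) : ℝ) = ‖(s n).vec‖⁻¹ := by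
    intro n
    have h₁ : P.form (φ n) (φ n) = ‖(s n).vec‖ ^ 2 := by
      rw [form_eq_integral hA hB (hmem n) (hmem n), ← real_inner_self_eq_norm_sq, Sol.vec, inner_toLp]
      refine integral_congr_ae ?_
      filter_upwards [hae n] with x hx
      rw [hx]
    rw [h₁, rpow_neg (sq_nonneg _), ← sqrt_eq_rpow, sqrt_sq (norm_nonneg _)]
  have hnmem : ∀ n, MemLp (P.normalized (φ n)) 2 P.weight := fun n => (hmem n).const_mul _
  have hcoeff : ∀ n, P.coeff φ f n = inner ℝ (hf.toLp f) (b n) := by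
    intro n
    rw [coeff, form_eq_integral hA hB hf (hnmem n), hb, real_inner_smul_right, Sol.vec,
      inner_toLp, ← integral_const_mul]
    refine integral_congr_ae ?_
    filter_upwards [hae n] with x hx
    rw [normalized, hnorm, hx, mul_left_comm, Sol.vec]
  have hsum := b.hasSum_inner_mul_inner (hf.toLp f) (hf.toLp f)
  rw [inner_toLp, ← form_eq_integral hA hB hf hf] at hsum
  have hterm : (fun n => P.coeff φ f n ^ 2)
      = fun n => inner ℝ (hf.toLp f) (b n) * inner ℝ (b n) (hf.toLp f) := by
    ext n
    rw [hcoeff, sq, real_inner_comm (b n)]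
  rwa [hterm]

end TwoIntervalSL

end

theorem mainTheorem5 (P : TwoIntervalSL) (hp₁ : 0 < P.p₁) (hp₂ : 0 < P.p₂)
    (hq : P.PotentialRegular) (h₁₂ : 0 < P.Δ₁₂) (h₃₄ : 0 < P.Δ₃₄) :
    (∃ (lam : ℕ → ℝ) (φ : ℕ → ℝ → ℝ), P.IsEigensystem lam φ) ∧
    ∀ (lam : ℕ → ℝ) (φ : ℕ → ℝ → ℝ), P.IsEigensystem lam φ →
      ∀ f : ℝ → ℝ, MemLp f 2 (volume.restrict (Set.Ico (-Real.pi) 0 ∪ Set.Ioc 0 Real.pi)) →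
        HasSum (fun n => P.coeff φ f n ^ 2)
          (P.Δ₃₄ / P.p₁ * (∫ x in (-Real.pi)..0, f x ^ 2) +
            P.Δ₁₂ / P.p₂ * ∫ x in (0)..Real.pi, f x ^ 2) := by
  obtain ⟨Q⟩ := hq.nonempty_extension
  refine ⟨TwoIntervalSL.exists_isEigensystem hp₁ hp₂ h₁₂ h₃₄ Q, fun lam φ h f hf => ?_⟩
  simpa only [TwoIntervalSL.form, ← sq] using
    h.hasSum_coeff_sq hp₁ hp₂ h₁₂ h₃₄ Q (P.memLp_weight hf)
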